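/- **Notation.** Throughout, $p$ is a prime, $\mathbb N=\{1,2,\dots\}$, and $\mathbb E_{\mathbf x}$, $\mathbb E_n$ are the averages over $\mathbf x\in\mathbb F_p^D$ and $n\in\mathbb F_p$. A function is 1-bounded if its values have modulus at most $1$; $\mathcal C$ is complex conjugation; integer vectors and polynomials are reduced mod $p$ where needed. The degree of $\mathbf p\in\mathbb Z[n]^D$ is the maximum of the degrees of its coordinates, where constants (including $0$) have degree $0$. Polynomial maps are essentially distinct if their pairwise differences are nonconstant. For subgroups $H_1,\dots,H_s$ ($s\ge 1$) of a finite abelian group $G$ and $f:G\to\mathbb C$, $$\|f\|_{H_1,\dots,H_s}=\Big(\mathbb E_{x\in G}\,\mathbb E_{h_1\in H_1}\cdots\mathbb E_{h_s\in H_s}\prod_{\underline\epsilon\in\{0,1\}^s}\mathcal C^{|\underline\epsilon|}f(x+\underline\epsilon\cdot\underline h)\Big)^{1/2^s},$$ and $\|f\|_{\mathbf b_1,\dots,\mathbf b_s}$ is this norm on $\mathbb F_p^D$ for $H_i=\langle \mathbf b_i\rangle$; $\mathbf b^{\times s}$ means that $\mathbf b$ is repeated $s$ times. For $\mathbf u\in\mathbb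 Z^D$, $\mathfrak D_d(\mathbf u)$ is the set of the functions $$\mathbf x\mapsto \mathbb E_{\underline h\in\mathbb F_p^k}\prod_{\underline\epsilon\in\{0,1\}^k\setminus\{\underline 0\}}\mathcal C^{|\underline\epsilon|}g(\mathbf x+(\underline\epsilon\cdot\underline h)\mathbf u)$$ with $1\le k\le d$ and $g:\mathbb F_p^D\to\mathbb C$ 1-bounded. **(I)** Let $d,D,\ell\in\mathbb N$. There exist $s,K\in\mathbb N$ and $C\in\mathbb R$, depending only on $d,D,\ell$, with the following property. Let $\mathbf p_1,\dots,\mathbf p_\ell\in\mathbb Z[n]^D$ be essentially distinct with $\deg\mathbf p_\ell=\max_{j}\deg\mathbf p_j=d$ and $\mathbf p_j(n)=\sum_{i=0}^d\mathbf a_{ji}n^i$. Put $\mathbf p_0=\mathbf 0$, $\mathbf a_{0i}=\mathbf 0$ and $d_{\ell j}=\deg(\mathbf p_\ell-\mathbf p_j)$ for $0\le j<\ell$. Then for every prime $p$ and all 1-bounded $f_0,\dots,f_\ell:\mathbb F_p^D\to\mathbb C$, $$\Big|\mathbb E_{\mathbf x}\mathbb E_n f_0(\mathbf x)f_1(\mathbf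 x+\mathbf p_1(n))\cdots f_\ell(\mathbf x+\mathbf p_\ell(n))\Big|^{K}\le \|f_\ell\|_{\mathbf a_{\ell d_{\ell 0}}^{\times s},(\mathbf a_{\ell d_{\ell 1}}-\mathbf a_{1d_{\ell 1}})^{\times s},\dots,(\mathbf a_{\ell d_{\ell(\ell-1)}}-\mathbf a_{(\ell-1)d_{\ell(\ell-1)}})^{\times s}}+\frac Cp.$$ **(II)** Let $d,\ell,L\in\mathbb N$. There exist $s,K\in\mathbb N$ and $C\in\mathbb R$, depending only on $d,\ell,L$, with the following property. Let $D\in\mathbb N$, let $\mathbf v_1,\dots,\mathbf v_\ell,\mathbf u_1,\dots,\mathbf u_L\in\mathbb Z^D$, and let $p_1,\dots,p_\ell,q_1,\dots,q_L\in\mathbb Z[n]$ have degree at most $d$, with $p_j(n)=\sum_{i=0}^d a_{ji}n^i$. Put $\mathbf v_0=\mathbf 0$, $p_0=0$, $a_{0i}=0$ and $d_{j\ell}=\deg(\mathbf v_\ell p_\ell-\mathbf v_jp_j)$, and assume that $\mathbf v_\ell p_\ell-\mathbf v_jp_j$ is nonconstant for $0\le j<\ell$. Then there are vectors $$\mathbf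 b_1,\dots,\mathbf b_s\in\{a_{\ell d_{j\ell}}\mathbf v_\ell-a_{jd_{j\ell}}\mathbf v_j:\ 0\le j<\ell\}$$ such that for every prime $p$, all 1-bounded $f_0,\dots,f_\ell:\mathbb F_p^D\to\mathbb C$ and all 1-bounded $\mathcal D_1,\dots,\mathcal D_L$ with $\mathcal D_j\in\mathfrak D_d(\mathbf u_j)$, $$\Big|\mathbb E_{\mathbf x}\mathbb E_n f_0(\mathbf x)\prod_{j=1}^\ell f_j(\mathbf x+\mathbf v_jp_j(n))\prod_{j=1}^L\mathcal D_j(\mathbf x+\mathbf u_jq_j(n))\Big|^{K}\le\|f_\ell\|_{\mathbf b_1,\dots,\mathbf b_s}+\frac Cp.$$ -/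

import Mathlib

open scoped BigOperators Polynomial

noncomputable section

namespace BoxControl

/-- A function is 1-bounded if it takes values in the closed unit disc. -/
def OneBounded {G : Type*} (f : G → ℂ) : Prop := ∀ x, ‖f x‖ ≤ 1

open scoped Classical in
/-- The average over `x ∈ G` and `h i ∈ H i` (for `i ∈ ι`) of the product, over all
`ε ∈ {0,1}^ι`, of `𝒞^|ε| f (x + ε · h)`, where `𝒞` is complex conjugation. A vector
`ε ∈ {0,1}^ι` is encoded by its support, a finite subset of `ι`. -/
def boxAverage {G ι : Type*} [AddCommGroup G] [Fintype G] [Fintype ι]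
    (H : ι → AddSubgroup G) (f : G → ℂ) : ℂ :=
  𝔼 x : G, 𝔼 h : ((i : ι) → H i),
    ∏ ε : Finset ι, (starRingEnd ℂ)^[ε.card] (f (x + ∑ i ∈ ε, (h i : G)))

/-- The (Gowers) box norm of `f` along the finite family of subgroups `H`; its degree is the number
of members of the family, counted with repetition. For a nonempty family `boxAverage H f` is a
nonnegative real number, so that taking its absolute value before the root changes nothing. -/
def boxNorm {G ι : Type*} [AddCommGroup G] [Fintype G] [Fintype ι]
    (H : ι → AddSubgroup G) (f : G → ℂ) : ℝ :=
  ‖boxAverage H f‖ ^ ((1 : ℝ) / 2 ^ Fintype.card ι)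

/-- Reduction modulo `p` of an integer vector. -/
def redVec (p : ℕ) {D : ℕ} (v : Fin D → ℤ) : Fin D → ZMod p := fun k => (v k : ZMod p)

/-- The box norm on `𝔽_p^D` along the cyclic subgroups generated by the reductions modulo `p` of the
integer vectors `b i`. -/
def boxNormAlong (p : ℕ) [Fact p.Prime] {D : ℕ} {ι : Type*} [Fintype ι]
    (b : ι → Fin D → ℤ) (f : (Fin D → ZMod p) → ℂ) : ℝ :=
  boxNorm (fun i => AddSubgroup.zmultiples (redVec p (b i))) f

/-- The polynomial maps `ℤ[n]^D`. -/
abbrev VecPoly (D : ℕ) : Type := Fin D → ℤ[X]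

/-- The degree of a polynomial map (the maximum of the degrees of its coordinates); constant maps,
including `0`, have degree `0`. -/
def vecDegree {D : ℕ} (P : VecPoly D) : ℕ := Finset.univ.sup fun k => (P k).natDegree

/-- The coefficient of `n ^ i` in a polynomial map, an integer vector. -/
def vecCoeff {D : ℕ} (P : VecPoly D) (i : ℕ) : Fin D → ℤ := fun k => (P k).coeff i

/-- The value in `𝔽_p^D` of a polynomial map at `n ∈ 𝔽_p`. -/
def evalMod (p : ℕ) {D : ℕ} (P : VecPoly D) (n : ZMod p) : Fin D → ZMod p :=
  fun k => (P k).eval₂ (Int.castRingHom (ZMod p)) n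

/-- The polynomial map `v φ(n)` for an integer vector `v` and `φ ∈ ℤ[n]`. -/
def vecMulPoly {D : ℕ} (v : Fin D → ℤ) (φ : ℤ[X]) : VecPoly D := fun k => Polynomial.C (v k) * φ

/-- Polynomial maps are essentially distinct if their pairwise differences are nonconstant. -/
def EssentiallyDistinct {D ℓ : ℕ} (P : Fin ℓ → VecPoly D) : Prop :=
  Pairwise fun i j => 0 < vecDegree (P i - P j)

/-- The family `P_0, P_1, …, P_ℓ` obtained from `P_1, …, P_ℓ` by putting `P_0 = 0`. The last member
`P_ℓ` is the value at `Fin.last ℓ`, the members `P_0, …, P_{ℓ-1}` are the values at `j.castSucc` for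
`j : Fin ℓ`. -/
def withZero {D ℓ : ℕ} (P : Fin ℓ → VecPoly D) : Fin (ℓ + 1) → VecPoly D := Fin.cons 0 P

/-- The difference `P_ℓ - P_j` for `j = 0, …, ℓ - 1`, where `P_0 = 0`. -/
def lastDiff {D ℓ : ℕ} (P : Fin ℓ → VecPoly D) (j : Fin ℓ) : VecPoly D :=
  withZero P (Fin.last ℓ) - withZero P j.castSucc

/-- The vector `a_{ℓ e} - a_{j e}` for `j = 0, …, ℓ - 1`, where `a_{i e}` is the coefficient of
`n ^ e` in `P_i`, where `e = deg (P_ℓ - P_j)`, and where `P_0 = 0`. -/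
def leadingDiff {D ℓ : ℕ} (P : Fin ℓ → VecPoly D) (j : Fin ℓ) : Fin D → ℤ :=
  vecCoeff (withZero P (Fin.last ℓ)) (vecDegree (lastDiff P j)) -
    vecCoeff (withZero P j.castSucc) (vecDegree (lastDiff P j))

/-- The counting operator `𝔼_x 𝔼_n f_0(x) f_1(x + P_1(n)) ⋯ f_ℓ(x + P_ℓ(n))` on `𝔽_p^D`. -/
def countingOp (p : ℕ) [Fact p.Prime] {D ℓ : ℕ} (P : Fin ℓ → VecPoly D)
    (f : Fin (ℓ + 1) → (Fin D → ZMod p) → ℂ) : ℂ :=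
  𝔼 x : Fin D → ZMod p, 𝔼 n : ZMod p,
    f 0 x * ∏ j : Fin ℓ, f j.succ (x + evalMod p (P j) n)

/-- The counting operator twisted by functions `g_1, …, g_L` along `Q_1, …, Q_L`:
`𝔼_x 𝔼_n f_0(x) ∏_j f_j(x + P_j(n)) ∏_j g_j(x + Q_j(n))`. -/
def twistedCountingOp (p : ℕ) [Fact p.Prime] {D ℓ L : ℕ} (P : Fin ℓ → VecPoly D)
    (Q : Fin L → VecPoly D) (f : Fin (ℓ + 1) → (Fin D → ZMod p) → ℂ)
    (g : Fin L → (Fin D → ZMod p) → ℂ) : ℂ :=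
  𝔼 x : Fin D → ZMod p, 𝔼 n : ZMod p,
    f 0 x * (∏ j : Fin ℓ, f j.succ (x + evalMod p (P j) n)) *
      ∏ j : Fin L, g j (x + evalMod p (Q j) n)

/-- The dual function of `f` of degree `k` along `v`:
`x ↦ 𝔼_{h ∈ 𝔽_p^k} ∏_{ε ∈ {0,1}^k, ε ≠ 0} 𝒞^|ε| f (x + (ε · h) v)`. -/
def dualFunction (p : ℕ) [Fact p.Prime] {D : ℕ} (k : ℕ) (v : Fin D → ℤ)
    (f : (Fin D → ZMod p) → ℂ) : (Fin D → ZMod p) → ℂ := fun x =>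
  𝔼 h : Fin k → ZMod p, ∏ ε ∈ (Finset.univ : Finset (Finset (Fin k))).erase ∅,
    (starRingEnd ℂ)^[ε.card] (f (x + (∑ i ∈ ε, h i) • redVec p v))

/-- The collection of dual functions, of 1-bounded functions, along `v` of degree at most `d`. -/
def dualFunctions (p : ℕ) [Fact p.Prime] {D : ℕ} (d : ℕ) (v : Fin D → ℤ) :
    Set ((Fin D → ZMod p) → ℂ) :=
  {F | ∃ k, 1 ≤ k ∧ k ≤ d ∧ ∃ f, OneBounded f ∧ F = dualFunction p k v f}

end BoxControl

end

open BoxControl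

open scoped BigOperators Polynomial

/-! Translating `x` by `-P_ℓ(n)` fixes `f = f_ℓ` at `x` and moves the other functions along the
differences `P_j - P_ℓ`, where `P_0 = 0`. These are grouped into classes by degree and leading
coefficient. The classes are eliminated from the least degree upwards, while `f` is kept as a
weight.

To eliminate a class of degree `e` with leading coefficient `β` (`IsSorted.exists_remove`), a
translation along `β n^e` lowers its degree, and a PET induction built on van der Corput
(`removableBelow`) removes it entirely. The price is that the remaining weight becomes a product
over a cube: at the vertex `ε` it is translated by a polynomial of degree less than `e`, whose
coefficient in degree `e - 1` is exactly `-e (ε·h) β`. The other classes are copied, but keep their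
degrees and leading coefficients. The copies of `f` at nonempty vertices form new classes of degree
`e - 1` whose leading coefficients lie on the line of `β`, so no new direction ever arises
(`Controlled.update_succ`). When `e = 1` the translations are constant: `f` turns into a cube
derivative along multiples of `β`, and averaging over `h` adds this direction to the box norm
(`Controlled.update_one`, `expect_boxNorm_cubeDeriv_le`).

The error `C/p` accounts for the `h` with some `ε·h = 0` and for small `p`, where `e` may vanish mod
`p`. If a leading coefficient itself vanishes mod `p`, the box norm has a trivial direction and
dominates `𝔼 ‖f‖`.

A dual function is expanded, and its averaging variables become further coordinates `y`. Its shift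
by `q(n) u` is produced by moving one coordinate of `y` by `q(n)`, so its factors move in `x` just
as `f_0` does. Since classes look only at the `x`-component, dual functions contribute no directions
(`twistedCountingOp_eq`). -/

namespace BoxControl

/-! ### Averages -/

lemma expect_add_right {G M : Type*} [AddGroup G] [Fintype G] [AddCommMonoid M] [Module ℚ≥0 M]
    (f : G → M) (c : G) : 𝔼 x, f (x + c) = 𝔼 x, f x :=
  Fintype.expect_equiv (Equiv.addRight c) _ _ fun _ => rfl

lemma expect_pow_le {ι : Type*} [Fintype ι] [Nonempty ι] (f : ι → ℝ) (hf : ∀ i, 0 ≤ f i) (n : ℕ) :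
    (𝔼 i, f i) ^ n ≤ 𝔼 i, f i ^ n := by
  have h := Real.pow_arith_mean_le_arith_mean_pow Finset.univ
    (fun _ : ι => (Fintype.card ι : ℝ)⁻¹) f (fun _ _ => by positivity)
    (by simp) (fun i _ => hf i) n
  simpa only [Fintype.expect_eq_sum_div_card, div_eq_inv_mul, Finset.mul_sum] using h

lemma norm_expect_pow_le {ι : Type*} [Fintype ι] [Nonempty ι] (f : ι → ℂ) (n : ℕ) :
    ‖𝔼 i, f i‖ ^ n ≤ 𝔼 i, ‖f i‖ ^ n :=
  (pow_le_pow_left₀ (norm_nonneg _) (RCLike.norm_expect_le (K := ℂ)) n).trans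
    (expect_pow_le _ (fun _ => norm_nonneg _) n)

lemma norm_expect_le_one {ι : Type*} [Fintype ι] [Nonempty ι] {f : ι → ℂ} (hf : ∀ i, ‖f i‖ ≤ 1) :
    ‖𝔼 i, f i‖ ≤ 1 :=
  (RCLike.norm_expect_le (K := ℂ)).trans
    (Finset.expect_le Finset.univ_nonempty fun i _ => hf i)

lemma conj_expect {ι : Type*} (s : Finset ι) (f : ι → ℂ) :
    starRingEnd ℂ (𝔼 i ∈ s, f i) = 𝔼 i ∈ s, starRingEnd ℂ (f i) := by
  simp [Finset.expect_eq_sum_div_card, map_sum]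

lemma ofReal_expect {ι : Type*} (s : Finset ι) (f : ι → ℝ) :
    ((𝔼 i ∈ s, f i : ℝ) : ℂ) = 𝔼 i ∈ s, (f i : ℂ) := by
  simp [Finset.expect_eq_sum_div_card]

/-- The square of the modulus of an average over a finite group. -/
lemma normSq_expect {G : Type*} [AddGroup G] [Fintype G] (f : G → ℂ) :
    ((‖𝔼 n, f n‖ ^ 2 : ℝ) : ℂ) = 𝔼 t, 𝔼 n, f n * starRingEnd ℂ (f (n + t)) := by
  rw [Finset.expect_comm]
  have (n : G) : 𝔼 t, f n * starRingEnd ℂ (f (n + t)) = f n * starRingEnd ℂ (𝔼 t, f t) := by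
    rw [← Finset.mul_expect, conj_expect]
    congr 1
    exact Fintype.expect_equiv (Equiv.addLeft n) _ _ fun _ => rfl
  simp_rw [this]
  rw [← Finset.expect_mul, Complex.mul_conj']
  norm_cast

/-- The Cauchy–Schwarz inequality followed by the van der Corput differencing. -/
lemma vanDerCorput {Z G : Type*} [Fintype Z] [Nonempty Z] [AddGroup G] [Fintype G]
    (u : Z → ℂ) (hu : OneBounded u) (B : Z → G → ℂ) :
    ‖𝔼 z, 𝔼 n, u z * B z n‖ ^ 2 ≤
      𝔼 t, ‖𝔼 z, 𝔼 n, B z n * starRingEnd ℂ (B z (n + t))‖ := by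
  calc ‖𝔼 z, 𝔼 n, u z * B z n‖ ^ 2 ≤ 𝔼 z, ‖𝔼 n, u z * B z n‖ ^ 2 := norm_expect_pow_le _ 2
    _ ≤ 𝔼 z, ‖𝔼 n, B z n‖ ^ 2 := by
        refine Finset.expect_le_expect fun z _ => ?_
        rw [← Finset.mul_expect, norm_mul]
        gcongr
        exact mul_le_of_le_one_left (norm_nonneg _) (hu z)
    _ = ‖𝔼 z, 𝔼 t, 𝔼 n, B z n * starRingEnd ℂ (B z (n + t))‖ := by
        simp_rw [← normSq_expect]
        rw [← ofReal_expect, Complex.norm_real, Real.norm_of_nonneg]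
        exact Finset.expect_nonneg fun _ _ => by positivity
    _ ≤ _ := by
        rw [Finset.expect_comm]
        exact RCLike.norm_expect_le (K := ℂ)

/-! ### Iterated conjugation and cube derivatives -/

lemma iter_conj_mul (n : ℕ) (a b : ℂ) : (starRingEnd ℂ)^[n] (a * b) =
    (starRingEnd ℂ)^[n] a * (starRingEnd ℂ)^[n] b :=
  iterate_map_mul _ n a b

lemma iter_conj_prod {ι : Type*} (n : ℕ) (s : Finset ι) (f : ι → ℂ) :
    (starRingEnd ℂ)^[n] (∏ i ∈ s, f i) = ∏ i ∈ s, (starRingEnd ℂ)^[n] (f i) := by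
  induction n with
  | zero => simp
  | succ n ih => simp only [Function.iterate_succ', Function.comp_apply, ih, map_prod]

lemma norm_iter_conj (n : ℕ) (a : ℂ) : ‖(starRingEnd ℂ)^[n] a‖ = ‖a‖ := by
  induction n with
  | zero => simp
  | succ n ih => simp only [Function.iterate_succ', Function.comp_apply, ih, RCLike.norm_conj]

lemma iter_conj_add (m n : ℕ) (a : ℂ) :
    (starRingEnd ℂ)^[m] ((starRingEnd ℂ)^[n] a) = (starRingEnd ℂ)^[m + n] a :=
  (Function.iterate_add_apply _ m n a).symm

lemma norm_prod_le_one {ι : Type*} (s : Finset ι) {f : ι → ℂ} (hf : ∀ i ∈ s, ‖f i‖ ≤ 1) :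
    ‖∏ i ∈ s, f i‖ ≤ 1 := by
  rw [norm_prod]
  exact Finset.prod_le_one (fun _ _ => norm_nonneg _) hf

/-- The multiplicative derivative of `f` along the cube spanned by the family `v`. -/
def cubeDeriv {G τ : Type*} [AddCommGroup G] [Fintype τ] (f : G → ℂ) (v : τ → G) (x : G) : ℂ :=
  ∏ ε : Finset τ, (starRingEnd ℂ)^[ε.card] (f (x + ∑ i ∈ ε, v i))

lemma OneBounded.cubeDeriv {G τ : Type*} [AddCommGroup G] [Fintype τ] {f : G → ℂ}
    (hf : OneBounded f) (v : τ → G) : OneBounded (cubeDeriv f v) := fun x =>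
  norm_prod_le_one _ fun ε _ => by rw [norm_iter_conj]; exact hf _

/-- Products over the subsets of a disjoint union. -/
lemma prod_finset_sum {τ υ M : Type*} [Fintype τ] [Fintype υ] [CommMonoid M]
    (g : Finset (τ ⊕ υ) → M) :
    ∏ ε, g ε = ∏ ε' : Finset υ, ∏ ε : Finset τ, g (ε.disjSum ε') := by
  rw [Finset.prod_comm, ← Fintype.prod_prod_type']
  exact Fintype.prod_equiv Finset.sumEquiv.toEquiv _ _ fun ε =>
    congrArg g Finset.toLeft_disjSum_toRight.symm

lemma cubeDeriv_sum {G τ υ : Type*} [AddCommGroup G] [Fintype τ] [Fintype υ] (f : G → ℂ)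
    (v : τ ⊕ υ → G) :
    cubeDeriv f v = cubeDeriv (cubeDeriv f (v ∘ Sum.inl)) (v ∘ Sum.inr) := by
  funext x
  simp only [cubeDeriv, prod_finset_sum, iter_conj_prod, iter_conj_add, Finset.card_disjSum,
    Finset.sum_disjSum, Function.comp_apply]
  refine Finset.prod_congr rfl fun ε' _ => Finset.prod_congr rfl fun ε _ => ?_
  rw [add_comm ε.card, add_assoc, add_comm (∑ i ∈ ε, _)]

lemma cubeDeriv_equiv {G τ υ : Type*} [AddCommGroup G] [Fintype τ] [Fintype υ] (f : G → ℂ)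
    (e : τ ≃ υ) (v : υ → G) : cubeDeriv f (v ∘ e) = cubeDeriv f v := by
  funext x
  exact Fintype.prod_equiv e.finsetCongr _ _ fun ε => by simp

lemma cubeDeriv_unique {G τ : Type*} [AddCommGroup G] [Fintype τ] [Unique τ] (f : G → ℂ)
    (v : τ → G) (x : G) : cubeDeriv f v x = f x * starRingEnd ℂ (f (x + v default)) := by
  classical
  have : (Finset.univ : Finset (Finset τ)) = {∅, {default}} := by
    ext ε
    simp only [Finset.mem_univ, Finset.mem_insert, Finset.mem_singleton, true_iff]
    exact (Finset.subset_singleton_iff (a := (default : τ))).1 fun i _ => by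
      simp [Subsingleton.elim i default]
  rw [cubeDeriv, this, Finset.prod_pair (by simp)]
  simp

/-! ### Box norms -/

section BoxNorm

variable {G : Type*} [AddCommGroup G] [Fintype G]

lemma boxAverage_eq {ι : Type*} [Fintype ι] (H : ι → AddSubgroup G) [Fintype ((i : ι) → H i)]
    (f : G → ℂ) :
    boxAverage H f = 𝔼 x : G, 𝔼 h : ((i : ι) → H i), cubeDeriv f (fun i => (h i : G)) x := by
  unfold boxAverage cubeDeriv
  refine Finset.expect_congr rfl fun x _ => ?_
  convert rfl

open scoped Classical in
lemma boxAverage_equiv {ι κ : Type*} [Fintype ι] [Fintype κ] (e : ι ≃ κ) (H : κ → AddSubgroup G)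
    (f : G → ℂ) : boxAverage (H ∘ e) f = boxAverage H f := by
  rw [boxAverage_eq, boxAverage_eq]
  refine Finset.expect_congr rfl fun x _ => ?_
  refine Fintype.expect_equiv (e.piCongrLeft (fun i => H i)) _ _ fun h => ?_
  rw [← cubeDeriv_equiv f e]
  congr 1
  funext i
  simp [Equiv.piCongrLeft_apply_apply]

open scoped Classical in
-- The cube over a disjoint union of directions is a cube of cubes, so differencing can be done in
-- two stages.
lemma boxAverage_sum {ι κ : Type*} [Fintype ι] [Fintype κ] (H : ι ⊕ κ → AddSubgroup G)
    (f : G → ℂ) : boxAverage H f =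
      𝔼 k : ((i : κ) → H (Sum.inr i)), boxAverage (H ∘ Sum.inl) (cubeDeriv f fun i => (k i : G)) := by
  have key (x : G) : 𝔼 h : ((i : ι ⊕ κ) → H i), cubeDeriv f (fun i => (h i : G)) x =
      𝔼 h : ((i : ι) → H (Sum.inl i)), 𝔼 k : ((i : κ) → H (Sum.inr i)),
        cubeDeriv (cubeDeriv f fun i => (k i : G)) (fun i => (h i : G)) x := by
    rw [← Finset.expect_product', Finset.univ_product_univ]
    refine Fintype.expect_equiv (Equiv.sumPiEquivProdPi fun i => H i) _ _ fun h => ?_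
    rw [← cubeDeriv_equiv f (Equiv.sumComm κ ι), cubeDeriv_sum]
    rfl
  rw [boxAverage_eq]
  simp_rw [key, boxAverage_eq]
  conv_rhs => rw [Finset.expect_comm]
  refine Finset.expect_congr rfl fun x _ => ?_
  exact Finset.expect_comm _ _ _

open scoped Classical in
lemma boxAverage_unique {κ : Type*} [Fintype κ] [Unique κ] (H : κ → AddSubgroup G) (f : G → ℂ) :
    boxAverage H f = ((𝔼 x, ‖𝔼 k : H default, f (x + k)‖ ^ 2 : ℝ) : ℂ) := by
  rw [boxAverage_eq, ofReal_expect]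
  simp_rw [normSq_expect, cubeDeriv_unique]
  have h1 (x : G) : 𝔼 h : ((i : κ) → H i), f x * starRingEnd ℂ (f (x + h default)) =
      𝔼 k : H default, f x * starRingEnd ℂ (f (x + k)) :=
    Fintype.expect_equiv (Equiv.piUnique fun i => H i) _ _ fun h => rfl
  simp_rw [h1]
  rw [Finset.expect_comm]
  conv_rhs => rw [Finset.expect_comm]
  refine Finset.expect_congr rfl fun t _ => ?_
  rw [Finset.expect_comm]
  have (n : H default) : 𝔼 x : G, f (x + n) * starRingEnd ℂ (f (x + ↑(n + t))) =
      𝔼 x, f x * starRingEnd ℂ (f (x + t)) := by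
    refine Eq.trans ?_ (expect_add_right _ (n : G))
    refine Finset.expect_congr rfl fun x _ => ?_
    simp [add_assoc]
  simp_rw [this]
  rw [Fintype.expect_const]

open scoped Classical in
-- Singling out one direction exhibits the box average as a mean of squares; positivity and
-- monotonicity of box norms both come from this.
lemma boxAverage_sum_unique {ι κ : Type*} [Fintype ι] [Fintype κ] [Unique κ]
    (H : ι ⊕ κ → AddSubgroup G) (f : G → ℂ) :
    boxAverage H f = ((𝔼 h : ((i : ι) → H (Sum.inl i)), 𝔼 x,
      ‖𝔼 k : H (Sum.inr default), cubeDeriv f (fun i => (h i : G)) (x + k)‖ ^ 2 : ℝ) : ℂ) := by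
  rw [← boxAverage_equiv (Equiv.sumComm κ ι), boxAverage_sum, ofReal_expect]
  simp_rw [boxAverage_unique]
  rfl

lemma boxAverage_nonneg {ι : Type*} [Fintype ι] [Nonempty ι] (H : ι → AddSubgroup G) (f : G → ℂ) :
    boxAverage H f = (‖boxAverage H f‖ : ℂ) := by
  classical
  obtain ⟨i₀⟩ := ‹Nonempty ι›
  let e : {i // i ≠ i₀} ⊕ {i // i = i₀} ≃ ι := (Equiv.sumComm _ _).trans (Equiv.sumCompl (· = i₀))
  rw [← boxAverage_equiv e, boxAverage_sum_unique, Complex.norm_real, Real.norm_of_nonneg]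
  exact Finset.expect_nonneg fun _ _ => Finset.expect_nonneg fun _ _ => by positivity

/-- Averaging over the extra direction does not change the mean over `x`, so the claim is
Cauchy–Schwarz applied to the mean of squares in `boxAverage_sum_unique`. -/
lemma norm_boxAverage_sq_le {ι κ : Type*} [Fintype ι] [Fintype κ] [Unique κ]
    (H : ι ⊕ κ → AddSubgroup G) (f : G → ℂ) :
    ‖boxAverage (H ∘ Sum.inl) f‖ ^ 2 ≤ ‖boxAverage H f‖ := by
  classical
  rw [boxAverage_sum_unique H, Complex.norm_real, Real.norm_of_nonneg
    (Finset.expect_nonneg fun _ _ => Finset.expect_nonneg fun _ _ => by positivity),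
    boxAverage_eq, Finset.expect_comm]
  refine (norm_expect_pow_le _ 2).trans (Finset.expect_le_expect fun h _ => ?_)
  refine le_trans (le_of_eq ?_) (norm_expect_pow_le _ 2)
  congr 2
  rw [Finset.expect_comm]
  simp_rw [expect_add_right (cubeDeriv f _)]
  rw [Fintype.expect_const]

lemma norm_boxAverage_le_one {ι : Type*} [Fintype ι] (H : ι → AddSubgroup G) {f : G → ℂ}
    (hf : OneBounded f) : ‖boxAverage H f‖ ≤ 1 := by
  classical
  rw [boxAverage_eq]
  exact norm_expect_le_one fun x => norm_expect_le_one fun h => hf.cubeDeriv _ x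

lemma boxNorm_nonneg {ι : Type*} [Fintype ι] (H : ι → AddSubgroup G) (f : G → ℂ) :
    0 ≤ boxNorm H f := by
  unfold boxNorm; positivity

lemma boxNorm_equiv {ι κ : Type*} [Fintype ι] [Fintype κ] (e : ι ≃ κ) (H : κ → AddSubgroup G)
    (f : G → ℂ) : boxNorm (H ∘ e) f = boxNorm H f := by
  rw [boxNorm, boxNorm, boxAverage_equiv, Fintype.card_congr e]

lemma boxNorm_comp_inl_le_of_unique {ι κ : Type*} [Fintype ι] [Fintype κ] [Unique κ]
    (H : ι ⊕ κ → AddSubgroup G) (f : G → ℂ) : boxNorm (H ∘ Sum.inl) f ≤ boxNorm H f := by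
  have h := norm_boxAverage_sq_le H f
  unfold boxNorm
  rw [Fintype.card_sum, Fintype.card_unique (α := κ)]
  calc ‖boxAverage (H ∘ Sum.inl) f‖ ^ ((1 : ℝ) / 2 ^ Fintype.card ι)
      = (‖boxAverage (H ∘ Sum.inl) f‖ ^ 2) ^ ((1 : ℝ) / 2 ^ (Fintype.card ι + 1)) := by
        rw [← Real.rpow_natCast ‖boxAverage (H ∘ Sum.inl) f‖ 2, ← Real.rpow_mul (norm_nonneg _)]
        congr 1
        rw [pow_succ]
        push_cast
        field_simp
    _ ≤ _ := by gcongr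

lemma boxNorm_comp_inl_le {ι : Type*} [Fintype ι] (n : ℕ) (H : ι ⊕ Fin n → AddSubgroup G)
    (f : G → ℂ) : boxNorm (H ∘ Sum.inl) f ≤ boxNorm H f := by
  induction n with
  | zero => exact (boxNorm_equiv (Equiv.sumEmpty ι (Fin 0)).symm H f).le
  | succ n ih =>
    let e : (ι ⊕ Fin n) ⊕ Fin 1 ≃ ι ⊕ Fin (n + 1) :=
      (Equiv.sumAssoc _ _ _).trans ((Equiv.refl ι).sumCongr finSumFinEquiv)
    rw [← boxNorm_equiv e H]
    have he : H ∘ Sum.inl = ((H ∘ e) ∘ Sum.inl) ∘ Sum.inl := by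
      funext i
      simp [e]
    rw [he]
    exact (ih _).trans (boxNorm_comp_inl_le_of_unique (H ∘ e) f)

/-- Enlarging the family of subgroups increases the box norm. -/
lemma boxNorm_comp_le {ι κ : Type*} [Fintype ι] [Fintype κ] {σ : ι → κ}
    (hσ : Function.Injective σ) (H : κ → AddSubgroup G) (f : G → ℂ) :
    boxNorm (H ∘ σ) f ≤ boxNorm H f := by
  classical
  let e : ι ⊕ Fin (Fintype.card {k // k ∉ Set.range σ}) ≃ κ :=
    ((Equiv.ofInjective σ hσ).sumCongr (Fintype.equivFin {k // k ∉ Set.range σ}).symm).trans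
      (Equiv.Set.sumCompl (Set.range σ))
  rw [← boxNorm_equiv e H]
  exact boxNorm_comp_inl_le _ (H ∘ e) f

lemma boxNorm_of_isEmpty {ι : Type*} [Fintype ι] [IsEmpty ι] (H : ι → AddSubgroup G) (f : G → ℂ) :
    boxNorm H f = ‖𝔼 x, f x‖ := by
  classical
  have h (v : ι → G) (x : G) : cubeDeriv f v x = f x := by
    rw [cubeDeriv, Fintype.prod_unique, Subsingleton.elim default (∅ : Finset ι)]
    simp
  rw [boxNorm, boxAverage_eq]
  simp [h]

lemma norm_expect_le_boxNorm {ι : Type*} [Fintype ι] (H : ι → AddSubgroup G) (f : G → ℂ) :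
    ‖𝔼 x, f x‖ ≤ boxNorm H f := by
  rw [← boxNorm_of_isEmpty (fun i : Fin 0 => i.elim0) f]
  have := boxNorm_comp_le (σ := fun i : Fin 0 => (i.elim0 : ι)) (fun i => i.elim0) H f
  convert this using 2

/-- A box norm one of whose directions is trivial controls the average of the modulus. -/
lemma expect_norm_le_boxNorm {ι : Type*} [Fintype ι] (H : ι → AddSubgroup G) (f : G → ℂ) {i : ι}
    (hi : H i = ⊥) : 𝔼 x, ‖f x‖ ≤ boxNorm H f := by
  classical
  -- By monotonicity the trivial direction alone suffices; its box norm is the `L²` norm of `f`.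
  refine le_trans ?_ (boxNorm_comp_le (σ := fun _ : Fin 1 => i) (fun a b _ => Subsingleton.elim _ _)
    H f)
  have h0 : boxAverage (H ∘ fun _ : Fin 1 => i) f = ((𝔼 x, ‖f x‖ ^ 2 : ℝ) : ℂ) := by
    rw [boxAverage_unique]
    congr 1
    refine Finset.expect_congr rfl fun x _ => ?_
    have : ∀ k : (H ∘ fun _ : Fin 1 => i) default, f (x + k) = f x := by
      rintro ⟨k, hk⟩
      have hk' : k ∈ H i := hk
      rw [hi, AddSubgroup.mem_bot] at hk'
      simp [hk']
    simp_rw [this, Fintype.expect_const]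
  rw [boxNorm, h0, Complex.norm_real, Real.norm_of_nonneg
    (Finset.expect_nonneg fun _ _ => by positivity)]
  have h1 := expect_pow_le (fun x => ‖f x‖) (fun _ => norm_nonneg _) 2
  have h2 : (0 : ℝ) ≤ 𝔼 x, ‖f x‖ := Finset.expect_nonneg fun _ _ => by positivity
  calc 𝔼 x, ‖f x‖ = ((𝔼 x, ‖f x‖) ^ 2) ^ ((1 : ℝ) / 2 ^ Fintype.card (Fin 1)) := by
        rw [← Real.rpow_natCast, ← Real.rpow_mul h2]
        norm_num
    _ ≤ _ := by gcongr

/-- The average, over parallelepipeds, of the box norms of the derivatives of a function. -/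
lemma expect_boxNorm_cubeDeriv_le {ι κ : Type*} [Fintype ι] [Nonempty ι] [Fintype κ]
    (H : ι ⊕ κ → AddSubgroup G) {f : G → ℂ} (hf : OneBounded f)
    [Fintype ((i : κ) → H (Sum.inr i))] :
    𝔼 k : ((i : κ) → H (Sum.inr i)), boxNorm (H ∘ Sum.inl) (cubeDeriv f fun i => (k i : G)) ≤
      boxNorm H f := by
  classical
  have e0 : (𝔼 k : ((i : κ) → H (Sum.inr i)),
      boxNorm (H ∘ Sum.inl) (cubeDeriv f fun i => (k i : G))) ^ 2 ^ Fintype.card ι ≤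
      ‖boxAverage H f‖ := by
    refine (expect_pow_le _ (fun _ => boxNorm_nonneg _ _) _).trans (le_of_eq ?_)
    rw [boxAverage_sum]
    have h1 : ∀ k : ((i : κ) → H (Sum.inr i)),
        boxAverage (H ∘ Sum.inl) (cubeDeriv f fun i => (k i : G)) =
          ((boxNorm (H ∘ Sum.inl) (cubeDeriv f fun i => (k i : G)) ^ 2 ^ Fintype.card ι : ℝ) : ℂ) := by
      intro k
      rw [boxAverage_nonneg, boxNorm, ← Real.rpow_natCast, ← Real.rpow_mul (norm_nonneg _)]
      congr 1
      push_cast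
      rw [one_div_mul_cancel (by positivity), Real.rpow_one]
    simp_rw [h1]
    rw [← ofReal_expect, Complex.norm_real, Real.norm_of_nonneg]
    · convert rfl
    · exact Finset.expect_nonneg fun _ _ => pow_nonneg (boxNorm_nonneg _ _) _
  have h2 : 0 ≤ 𝔼 k : ((i : κ) → H (Sum.inr i)),
      boxNorm (H ∘ Sum.inl) (cubeDeriv f fun i => (k i : G)) :=
    Finset.expect_nonneg fun _ _ => boxNorm_nonneg _ _
  calc _ = ((𝔼 k : ((i : κ) → H (Sum.inr i)),
      boxNorm (H ∘ Sum.inl) (cubeDeriv f fun i => (k i : G))) ^ 2 ^ Fintype.card ι) ^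
        ((1 : ℝ) / 2 ^ Fintype.card ι) := by
        rw [← Real.rpow_natCast, ← Real.rpow_mul h2]
        push_cast
        rw [mul_one_div_cancel (by positivity), Real.rpow_one]
    _ ≤ ‖boxAverage H f‖ ^ ((1 : ℝ) / 2 ^ Fintype.card ι) := by gcongr
    _ ≤ _ := by
        -- The base is at most `1`, so passing to the smaller exponent `1 / 2 ^ (|ι| + |κ|)` only
        -- increases the value.
        refine Real.rpow_le_rpow_of_exponent_ge' (norm_nonneg _) (norm_boxAverage_le_one H hf)
          (by positivity) ?_
        rw [Fintype.card_sum]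
        gcongr
        · norm_num
        · omega

end BoxNorm

end BoxControl

noncomputable section

namespace BoxControl

/-! ### Polynomial maps over a prime field -/

section PolyMap

variable {p : ℕ} {ι : Type*}

/-- The value at `n` of the polynomial map with coordinates `R k`. -/
def polyVal (R : ι → (ZMod p)[X]) (n : ZMod p) : ι → ZMod p := fun k => (R k).eval n

/-- The polynomial map `n ↦ R (n + t)`. -/
def polyShift (t : ZMod p) (R : ι → (ZMod p)[X]) : ι → (ZMod p)[X] :=
  fun k => Polynomial.taylor t (R k)

@[simp] lemma polyVal_zero (n : ZMod p) : polyVal (0 : ι → (ZMod p)[X]) n = 0 := by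
  funext k; simp [polyVal]

@[simp] lemma polyVal_add (R S : ι → (ZMod p)[X]) (n : ZMod p) :
    polyVal (R + S) n = polyVal R n + polyVal S n := by
  funext k; simp [polyVal]

@[simp] lemma polyVal_sub (R S : ι → (ZMod p)[X]) (n : ZMod p) :
    polyVal (R - S) n = polyVal R n - polyVal S n := by
  funext k; simp [polyVal]

@[simp] lemma polyVal_shift (t : ZMod p) (R : ι → (ZMod p)[X]) (n : ZMod p) :
    polyVal (polyShift t R) n = polyVal R (n + t) := by
  funext k; simp [polyVal, polyShift, Polynomial.taylor_eval]

@[simp] lemma polyShift_zero_left (R : ι → (ZMod p)[X]) : polyShift 0 R = R := by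
  funext k; simp [polyShift]

/-- Differencing lowers the degree. -/
lemma degree_sub_taylor_lt {R : Type*} [CommRing R] {f : R[X]} {d : ℕ} (hf : f.natDegree ≤ d)
    (t : R) : (f - Polynomial.taylor t f).degree < d := by
  rw [Polynomial.degree_lt_iff_coeff_zero]
  intro m hm
  rcases eq_or_lt_of_le (hf.trans hm) with h | h
  · rw [Polynomial.coeff_sub, ← h, Polynomial.coeff_taylor_natDegree, Polynomial.leadingCoeff,
      sub_self]
  · rw [Polynomial.coeff_sub, Polynomial.coeff_eq_zero_of_natDegree_lt h,
      Polynomial.coeff_eq_zero_of_natDegree_lt (by rwa [Polynomial.natDegree_taylor]), sub_self]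

end PolyMap

/-! ### Removing functions evaluated along polynomial maps -/

/-- The functions evaluated along the polynomial maps `R i` can be removed from an average with
arbitrary weights, at the cost of replacing the weight by its differences along a cube; the
weights are moreover translated by polynomial maps the degrees of whose coordinates are less
than `r`. -/
def Removable (p : ℕ) [Fact p.Prime] {ι I : Type} [Fintype ι] [DecidableEq ι] [Fintype I]
    (τ : Type) [Fintype τ] [DecidableEq τ] (r : ι → ℕ) (R : I → ι → (ZMod p)[X]) : Prop :=
  ∀ (a : (ι → ZMod p) → ZMod p → ℂ) (G : I → (ι → ZMod p) → ℂ), (∀ i, OneBounded (G i)) →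
    ∃ S : (τ → ZMod p) → Finset τ → ι → (ZMod p)[X],
      (∀ h, S h ∅ = 0) ∧ (∀ h ε k, (S h ε k).degree < r k) ∧
      ‖𝔼 z, 𝔼 n, a z n * ∏ i, G i (z + polyVal (R i) n)‖ ^ 2 ^ Fintype.card τ ≤
        𝔼 h : τ → ZMod p, ‖𝔼 z, 𝔼 n, ∏ ε : Finset τ, (starRingEnd ℂ)^[ε.card]
          (a (z + polyVal (S h ε) n) (n + ∑ i ∈ ε, h i))‖

section Removable

variable {p : ℕ} [Fact p.Prime] {ι I : Type} [Fintype ι] [DecidableEq ι] [Fintype I]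

lemma Removable.mono {τ : Type} [Fintype τ] [DecidableEq τ] {r r' : ι → ℕ}
    {R : I → ι → (ZMod p)[X]} (h : Removable p τ r R) (hr : ∀ k, r k ≤ r' k) :
    Removable p τ r' R := by
  intro a G hG
  obtain ⟨S, h1, h2, h3⟩ := h a G hG
  exact ⟨S, h1, fun h ε k => (h2 h ε k).trans_le (by exact_mod_cast hr k), h3⟩

lemma expect_translate (A : (ι → ZMod p) → ZMod p → ℂ) (g : ZMod p → ι → ZMod p) :
    𝔼 z, 𝔼 n, A (z + g n) n = 𝔼 z, 𝔼 n, A z n := by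
  rw [Finset.expect_comm]
  conv_rhs => rw [Finset.expect_comm]
  exact Finset.expect_congr rfl fun n _ => expect_add_right (fun z => A z n) (g n)

/-- Removal after a change of variables along a polynomial map `Q`. -/
lemma Removable.of_sub {τ : Type} [Fintype τ] [DecidableEq τ] {r : ι → ℕ}
    {R : I → ι → (ZMod p)[X]} (Q : ι → (ZMod p)[X]) (h : Removable p τ r fun i => R i - Q)
    (a : (ι → ZMod p) → ZMod p → ℂ) (G : I → (ι → ZMod p) → ℂ) (hG : ∀ i, OneBounded (G i)) :
    ∃ S : (τ → ZMod p) → Finset τ → ι → (ZMod p)[X],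
      (∀ h, S h ∅ = 0) ∧ (∀ h ε k, (S h ε k).degree < r k) ∧
      ‖𝔼 z, 𝔼 n, a z n * ∏ i, G i (z + polyVal (R i) n)‖ ^ 2 ^ Fintype.card τ ≤
        𝔼 h : τ → ZMod p, ‖𝔼 z, 𝔼 n, ∏ ε : Finset τ, (starRingEnd ℂ)^[ε.card]
          (a (z + polyVal (S h ε + (Q - polyShift (∑ i ∈ ε, h i) Q)) n) (n + ∑ i ∈ ε, h i))‖ := by
  -- The weight is taken in the coordinate `z + Q(n)`. Undoing this at a vertex, where `n` has
  -- become `n + ε·h`, leaves the drift `Q(n) - Q(n + ε·h)`.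
  obtain ⟨S, h1, h2, h3⟩ := h (fun z n => a (z - polyVal Q n) n) G hG
  refine ⟨S, h1, h2, ?_⟩
  convert h3 using 3
  · rw [← expect_translate _ fun n => -polyVal Q n]
    refine Finset.expect_congr rfl fun z _ => Finset.expect_congr rfl fun n _ => ?_
    simp only [polyVal_sub]
    simp only [sub_eq_add_neg]
    congr 1
    refine Finset.prod_congr rfl fun i _ => ?_
    congr 1
    abel
  · conv_rhs => rw [← expect_translate _ fun n => polyVal Q n]
    refine Finset.expect_congr rfl fun z _ => Finset.expect_congr rfl fun n _ => ?_
    refine Finset.prod_congr rfl fun ε _ => ?_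
    simp only [polyVal_sub, polyVal_add, polyVal_shift]
    congr 2
    abel

/-- The functions to be removed do not depend on `n`, so a single Cauchy–Schwarz step, hence a
one-dimensional cube, is enough. -/
lemma removable_zero {r : ι → ℕ} {R : I → ι → (ZMod p)[X]} (hR : ∀ i, R i = 0) :
    Removable p Unit r R := by
  intro a G hG
  refine ⟨fun _ _ => 0, fun _ => rfl, fun _ _ _ => by simp, ?_⟩
  have h := vanDerCorput (fun z => ∏ i, G i z)
    (fun z => norm_prod_le_one _ fun i _ => hG i z) a
  simp only [hR, polyVal_zero, add_zero, Fintype.card_unit, pow_one]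
  simp_rw [mul_comm (a _ _)]
  refine h.trans (le_of_eq ?_)
  refine (Fintype.expect_equiv (Equiv.funUnique Unit (ZMod p)) _ _ fun h => ?_).symm
  congr 1
  refine Finset.expect_congr rfl fun z _ => Finset.expect_congr rfl fun n _ => ?_
  exact cubeDeriv_unique (a z) h n

lemma expect_sum_arrow {τ υ F : Type*} [Fintype τ] [DecidableEq τ] [Fintype υ] [DecidableEq υ]
    [Fintype F] {N : Type*} [AddCommMonoid N] [Module ℚ≥0 N] (A : (τ ⊕ υ → F) → N) :
    𝔼 h, A h = 𝔼 h : τ → F, 𝔼 h' : υ → F, A (Sum.elim h h') := by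
  rw [← Finset.expect_product', Finset.univ_product_univ]
  exact Fintype.expect_equiv (Equiv.sumArrowEquivProdArrow _ _ _) _ _ fun h => by
    simp [Equiv.sumArrowEquivProdArrow]

/-- Removal of the functions of one class, followed by removal of the others. -/
lemma Removable.of_subtype {τ υ : Type} [Fintype τ] [DecidableEq τ] [Fintype υ] [DecidableEq υ]
    {r : ι → ℕ} {R : I → ι → (ZMod p)[X]} (P : I → Prop) [DecidablePred P] (Q : ι → (ZMod p)[X])
    (hQ : ∀ t k, ((Q - polyShift t Q) k).degree < r k)
    (h₁ : Removable p τ r fun i : {i // P i} => R i - Q)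
    (h₂ : ∀ (t : Finset τ → ZMod p) (S : Finset τ → ι → (ZMod p)[X]),
      (∀ ε k, (S ε k).degree < r k) →
      Removable p υ r fun i : {i // ¬ P i} × Finset τ => S i.2 + polyShift (t i.2) (R i.1)) :
    Removable p (τ ⊕ υ) r R := by
  intro a G hG
  obtain ⟨S, S0, Sr, hS⟩ := Removable.of_sub Q h₁
    (fun z n => a z n * ∏ i : {i // ¬ P i}, G i (z + polyVal (R i) n)) (fun i => G i)
    (fun i => hG i)
  set S₁ : (τ → ZMod p) → Finset τ → ι → (ZMod p)[X] :=
    fun h ε => S h ε + (Q - polyShift (∑ i ∈ ε, h i) Q) with hS₁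
  have S₁r (h ε k) : (S₁ h ε k).degree < r k :=
    (Polynomial.degree_add_le _ _).trans_lt (max_lt (Sr h ε k) (hQ _ k))
  -- The functions outside the class were part of the weight in the first removal, so there is now
  -- one translated copy of each per vertex; these are removed next.
  have h₃ (h : τ → ZMod p) := h₂ (fun ε => ∑ i ∈ ε, h i) (S₁ h) (S₁r h)
    (fun z n => ∏ ε : Finset τ, (starRingEnd ℂ)^[ε.card]
      (a (z + polyVal (S₁ h ε) n) (n + ∑ i ∈ ε, h i)))
    (fun i z => (starRingEnd ℂ)^[i.2.card] (G i.1 z))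
    (fun i z => by rw [norm_iter_conj]; exact hG _ _)
  choose S₂ S₂0 S₂r hS₂ using h₃
  refine ⟨fun h ε => S₂ (h ∘ Sum.inl) (h ∘ Sum.inr) ε.toRight +
      polyShift (∑ i ∈ ε.toRight, h (Sum.inr i)) (S₁ (h ∘ Sum.inl) ε.toLeft), fun h => ?_,
    fun h ε k => ?_, ?_⟩
  · have h1 : (∅ : Finset (τ ⊕ υ)).toLeft = ∅ := by ext; simp
    have h2 : (∅ : Finset (τ ⊕ υ)).toRight = ∅ := by ext; simp
    simp [h1, h2, S₂0, S0, hS₁]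
  · refine (Polynomial.degree_add_le _ _).trans_lt (max_lt (S₂r _ _ _ k) ?_)
    exact (Polynomial.degree_taylor _ _).trans_lt (S₁r _ _ k)
  rw [Fintype.card_sum, pow_add, pow_mul]
  have e1 : 𝔼 z, 𝔼 n, a z n * ∏ i, G i (z + polyVal (R i) n) =
      𝔼 z, 𝔼 n, (a z n * ∏ i : {i // ¬ P i}, G i (z + polyVal (R i) n)) *
        ∏ i : {i // P i}, G i (z + polyVal (R i) n) := by
    refine Finset.expect_congr rfl fun z _ => Finset.expect_congr rfl fun n _ => ?_
    rw [← Fintype.prod_subtype_mul_prod_subtype P]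
    ring
  rw [e1]
  refine (pow_le_pow_left₀ (by positivity) hS _).trans ((expect_pow_le _
    (fun _ => norm_nonneg _) _).trans ?_)
  rw [expect_sum_arrow]
  refine Finset.expect_le_expect fun h _ => ?_
  refine le_trans (le_of_eq ?_) ((hS₂ h).trans (le_of_eq ?_))
  · congr 2
    refine Finset.expect_congr rfl fun z _ => Finset.expect_congr rfl fun n _ => ?_
    rw [Fintype.prod_prod_type, Finset.prod_comm, ← Finset.prod_mul_distrib]
    refine Finset.prod_congr rfl fun ε _ => ?_
    rw [iter_conj_mul, iter_conj_prod]
    congr 1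
    refine Finset.prod_congr rfl fun i _ => ?_
    simp only [polyVal_add, polyVal_shift, hS₁, add_assoc]
  · refine Finset.expect_congr rfl fun h' _ => ?_
    congr 1
    refine Finset.expect_congr rfl fun z _ => Finset.expect_congr rfl fun n _ => ?_
    rw [prod_finset_sum]
    refine Finset.prod_congr rfl fun ε' _ => ?_
    rw [iter_conj_prod]
    refine Finset.prod_congr rfl fun ε _ => ?_
    rw [iter_conj_add, Finset.card_disjSum, add_comm ε'.card]
    congr 1
    simp only [Finset.toLeft_disjSum, Finset.toRight_disjSum, Finset.sum_disjSum, Sum.elim_inl,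
      Sum.elim_inr, Sum.elim_comp_inl, Sum.elim_comp_inr, polyVal_add, polyVal_shift]
    congr 1
    · abel
    · abel

end Removable

/-- The statement that boundedly many functions along polynomial maps of degree less than `d` are
removable. -/
def RemovableBelow (d : ℕ) : Prop :=
  ∀ M : ℕ, ∃ (τ : Type) (_ : Fintype τ) (_ : DecidableEq τ), ∀ (p : ℕ) [Fact p.Prime]
    (ι I : Type) [Fintype ι] [DecidableEq ι] [Fintype I] (r : ι → ℕ) (R : I → ι → (ZMod p)[X]),
    Fintype.card I ≤ M → (∀ i k, (R i k).degree < d) → (∀ i k, (R i k).natDegree ≤ r k) →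
    Removable p τ r R

lemma removableBelow_zero : RemovableBelow 0 := by
  refine fun M => ⟨Unit, inferInstance, inferInstance, fun p _ ι I _ _ _ r R _ hR _ => ?_⟩
  refine removable_zero fun i => funext fun k => ?_
  have := hR i k
  rwa [Nat.cast_zero, Nat.WithBot.lt_zero_iff, Polynomial.degree_eq_bot] at this

/-- Removal of `N` classes of polynomial maps, each with a common coefficient of degree `d`. -/
lemma exists_removable_of_classes {d : ℕ} (hd : RemovableBelow d) (N : ℕ) :
    ∀ M : ℕ, ∃ (τ : Type) (_ : Fintype τ) (_ : DecidableEq τ), ∀ (p : ℕ) [Fact p.Prime]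
      (ι I : Type) [Fintype ι] [DecidableEq ι] [Fintype I] (r : ι → ℕ) (R : I → ι → (ZMod p)[X])
      (c : I → ℕ) (γ : ℕ → ι → ZMod p),
      Fintype.card I ≤ M → (∀ i, c i < N) → (∀ k, r k ≤ d) → (∀ q k, r k < d → γ q k = 0) →
      (∀ i k, (R i k).natDegree ≤ r k) → (∀ i k, (R i k).coeff d = γ (c i) k) →
      Removable p τ r R := by
  induction N with
  | zero =>
    intro M
    obtain ⟨τ, i1, i2, h⟩ := hd M
    refine ⟨τ, i1, i2, fun p _ ι I _ _ _ r R c γ hI hc _ _ _ _ => h p ι I r R hI ?_ ?_⟩ <;>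
    exact fun i => absurd (hc i) (Nat.not_lt_zero _)
  | succ N ih =>
    intro M
    obtain ⟨τ, i1, i2, h1⟩ := hd M
    -- Removing the last class leaves a copy of every other function at each vertex of the cube.
    obtain ⟨υ, j1, j2, h2⟩ := ih (M * Fintype.card (Finset τ))
    refine ⟨τ ⊕ υ, inferInstance, inferInstance, fun p _ ι I _ _ _ r R c γ hI hc hr hγ hR hRc => ?_⟩
    -- The common top term of the class: subtracting it brings the class below degree `d`.
    set Q : ι → (ZMod p)[X] := fun k => Polynomial.C (γ N k) * Polynomial.X ^ d with hQ
    have hQr (k) : (Q k).natDegree ≤ r k := by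
      rcases lt_or_ge (r k) d with h | h
      · simp [hQ, hγ N k h]
      · exact (Polynomial.natDegree_C_mul_X_pow_le _ _).trans h
    classical
    refine Removable.of_subtype (fun i => c i = N) Q (fun t k => degree_sub_taylor_lt (hQr k) t)
      (h1 p ι _ r _ ((Fintype.card_subtype_le _).trans hI) ?_ ?_) fun t S hS =>
      h2 p ι _ r _ (fun i => c i.1) γ ?_ ?_ hr hγ ?_ ?_
    · rintro ⟨i, rfl⟩ k
      rw [Polynomial.degree_lt_iff_coeff_zero]
      intro m hm
      rcases eq_or_lt_of_le hm with rfl | hm'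
      · simp [hQ, hRc]
      · simp only [Pi.sub_apply, Polynomial.coeff_sub]
        rw [Polynomial.coeff_eq_zero_of_natDegree_lt (((hR i k).trans (hr k)).trans_lt hm'),
          Polynomial.coeff_eq_zero_of_natDegree_lt (((hQr k).trans (hr k)).trans_lt hm'), sub_self]
    · exact fun i k => (Polynomial.natDegree_sub_le _ _).trans (max_le (hR _ k) (hQr k))
    · rw [Fintype.card_prod]
      exact Nat.mul_le_mul_right _ ((Fintype.card_subtype_le _).trans hI)
    · exact fun i => lt_of_le_of_ne (Nat.lt_succ_iff.1 (hc _)) i.1.2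
    · intro i k
      refine (Polynomial.natDegree_add_le _ _).trans (max_le
        (Polynomial.natDegree_le_of_degree_le (hS _ k).le) ?_)
      exact (Polynomial.natDegree_taylor _ _).trans_le (hR _ k)
    -- Neither the shift of `n` nor a translation of lower degree affects the coefficient of degree
    -- `d`, so the class labels persist.
    · intro i k
      have h3 : (S i.2 k).coeff d = 0 :=
        Polynomial.coeff_eq_zero_of_degree_lt ((hS _ k).trans_le (by exact_mod_cast hr k))
      have h4 := Polynomial.coeff_eq_zero_of_degree_lt
        (degree_sub_taylor_lt ((hR i.1 k).trans (hr k)) (t i.2))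
      rw [Polynomial.coeff_sub, sub_eq_zero] at h4
      rw [Pi.add_apply, Polynomial.coeff_add, h3, zero_add, ← hRc, h4]
      rfl

/-- Induction on the degree, with each function placed in a class of its own. The cube depends only
on `d` and the number of functions, not on `p`, the coordinates or the polynomials. -/
theorem removableBelow (d : ℕ) : RemovableBelow d := by
  induction d with
  | zero => exact removableBelow_zero
  | succ d ih =>
    intro M
    obtain ⟨τ, i1, i2, h⟩ := exists_removable_of_classes ih M M
    refine ⟨τ, i1, i2, fun p _ ι I _ _ _ r R hI hRd hR => ?_⟩
    have hRd' (i k) : (R i k).natDegree ≤ d := by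
      have := (Polynomial.degree_lt_iff_coeff_zero _ _).1 (hRd i k)
      exact Polynomial.natDegree_le_iff_coeff_eq_zero.2 fun m hm => this m hm
    let e := Fintype.equivFin I
    refine Removable.mono (r := fun k => min (r k) d) (h p ι I _ R (fun i => e i)
      (fun q k => if hq : q < Fintype.card I then (R (e.symm ⟨q, hq⟩) k).coeff d else 0) hI
      (fun i => (e i).2.trans_le hI) (fun k => min_le_right _ _) ?_
      (fun i k => le_min (hR i k) (hRd' i k)) ?_) fun k => min_le_left _ _
    · intro q k hk
      have hk' : r k < d := by omega
      split_ifs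
      · exact Polynomial.coeff_eq_zero_of_natDegree_lt ((hR _ k).trans_lt hk')
      · rfl
    · intro i k
      simp

end BoxControl

end

noncomputable section

namespace BoxControl

/-! ### Families of polynomial maps sorted by degree and leading coefficient -/

/-- The polynomial maps `T i` on `𝔽_p^D × 𝔽_p^κ` are divided into classes labelled by pairs
`(e, q)` with `q < w e`; in the class `(e, q)` the first components have degree at most `e` with
coefficient `β (e, q)` in degree `e`, a nonzero vector on the line of some `b j`. The second
components are only required to have degree at most `d`. -/
structure IsSorted {p D : ℕ} {κ J I : Type} (d : ℕ) (w : ℕ → ℕ) (b : J → Fin D → ZMod p)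
    (c : I → ℕ × ℕ) (β : ℕ × ℕ → Fin D → ZMod p) (T : I → Fin D ⊕ κ → (ZMod p)[X]) : Prop where
  label_lt : ∀ i, (c i).2 < w (c i).1
  lead_ne_zero : ∀ e q, q < w e → β (e, q) ≠ 0
  lead_mem : ∀ e q, q < w e → ∃ (j : J) (a : ZMod p), β (e, q) = a • b j
  natDegree_le : ∀ i k, (T i (Sum.inl k)).natDegree ≤ (c i).1
  coeff_eq : ∀ i k, (T i (Sum.inl k)).coeff (c i).1 = β (c i) k
  natDegree_le' : ∀ i k, (T i (Sum.inr k)).natDegree ≤ d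

/-- The average of `f x ∏_i G_i ((x, y) + T_i(n))` over `x`, `y` and `n`. -/
def sortedAverage {p : ℕ} [Fact p.Prime] {D : ℕ} {κ I : Type} [Fintype κ] [DecidableEq κ]
    [Fintype I] (T : I → Fin D ⊕ κ → (ZMod p)[X]) (f : (Fin D → ZMod p) → ℂ)
    (G : I → (Fin D ⊕ κ → ZMod p) → ℂ) : ℂ :=
  𝔼 z : Fin D ⊕ κ → ZMod p, 𝔼 n : ZMod p, f (z ∘ Sum.inl) * ∏ i, G i (z + polyVal (T i) n)

lemma norm_sortedAverage_le_one {p : ℕ} [Fact p.Prime] {D : ℕ} {κ I : Type} [Fintype κ]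
    [DecidableEq κ] [Fintype I] (T : I → Fin D ⊕ κ → (ZMod p)[X]) {f : (Fin D → ZMod p) → ℂ}
    {G : I → (Fin D ⊕ κ → ZMod p) → ℂ} (hf : OneBounded f) (hG : ∀ i, OneBounded (G i)) :
    ‖sortedAverage T f G‖ ≤ 1 := by
  refine norm_expect_le_one fun z => norm_expect_le_one fun n => ?_
  rw [norm_mul]
  exact mul_le_one₀ (hf _) (norm_nonneg _) (norm_prod_le_one _ fun i _ => hG i _)

/-- The subgroups generated by the vectors `b j`, each repeated `s` times. -/
def lines {p D : ℕ} {J : Type} (b : J → Fin D → ZMod p) (s : ℕ) (x : J × Fin s) :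
    AddSubgroup (Fin D → ZMod p) :=
  AddSubgroup.zmultiples (b x.1)

/-- Averages along sorted families with class sizes `w` are controlled by box norms. -/
def Controlled (d : ℕ) (w : ℕ → ℕ) : Prop :=
  ∀ M : ℕ, ∃ (s K : ℕ) (C : ℝ), 1 ≤ s ∧ 1 ≤ K ∧ 0 ≤ C ∧
    ∀ (p : ℕ) [Fact p.Prime] (D : ℕ) (κ J I : Type) [Fintype κ] [DecidableEq κ] [Fintype J]
      [Nonempty J] [Fintype I] (b : J → Fin D → ZMod p) (c : I → ℕ × ℕ)
      (β : ℕ × ℕ → Fin D → ZMod p) (T : I → Fin D ⊕ κ → (ZMod p)[X])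
      (f : (Fin D → ZMod p) → ℂ) (G : I → (Fin D ⊕ κ → ZMod p) → ℂ),
      Fintype.card I ≤ M → IsSorted d w b c β T → OneBounded f → (∀ i, OneBounded (G i)) →
      ‖sortedAverage T f G‖ ^ K ≤ boxNorm (lines b s) f + C * (p : ℝ)⁻¹

lemma controlled_zero (d : ℕ) : Controlled d 0 := by
  intro M
  refine ⟨1, 1, 0, le_rfl, le_rfl, le_rfl, fun p _ D κ J I _ _ _ _ _ b c β T f G _ h _ _ => ?_⟩
  have : IsEmpty I := ⟨fun i => absurd (h.label_lt i) (Nat.not_lt_zero _)⟩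
  rw [pow_one, zero_mul, add_zero]
  refine le_trans (le_of_eq ?_) (norm_expect_le_boxNorm (lines b 1) f)
  simp [sortedAverage, expect_sum_arrow, Sum.elim_comp_inl]

/-! ### Removal of a class of least degree -/

section RemoveClass

variable {p D : ℕ} {κ J I : Type} {d e k : ℕ} {w : ℕ → ℕ} {b : J → Fin D → ZMod p}
  {c : I → ℕ × ℕ} {β : ℕ × ℕ → Fin D → ZMod p} {T : I → Fin D ⊕ κ → (ZMod p)[X]}

/-- The polynomial map `n ↦ (v n ^ e, 0)`. -/
def powMap {p D : ℕ} (κ : Type) (v : Fin D → ZMod p) (e : ℕ) : Fin D ⊕ κ → (ZMod p)[X] :=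
  Sum.elim (fun k => Polynomial.C (v k) * Polynomial.X ^ e) 0

lemma natDegree_powMap_le (v : Fin D → ZMod p) (e : ℕ) (k : Fin D) :
    (powMap κ v e (Sum.inl k)).natDegree ≤ e :=
  Polynomial.natDegree_C_mul_X_pow_le _ _

/-- Removal of the class `(e, k)` of least degree. -/
lemma IsSorted.exists_remove [Fact p.Prime] [Fintype κ] [DecidableEq κ] [Fintype I]
    {τ : Type} [Fintype τ] [DecidableEq τ] (h : IsSorted d w b c β T) (he : 1 ≤ e)
    (hτ : ∀ (I' : Type) [Fintype I'] (r : Fin D ⊕ κ → ℕ) (R : I' → Fin D ⊕ κ → (ZMod p)[X]),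
      Fintype.card I' ≤ Fintype.card I → (∀ i k, (R i k).degree < (max d e + 1 : ℕ)) →
      (∀ i k, (R i k).natDegree ≤ r k) → Removable p τ r R)
    (f : (Fin D → ZMod p) → ℂ) {G : I → (Fin D ⊕ κ → ZMod p) → ℂ} (hG : ∀ i, OneBounded (G i)) :
    ∃ S : (τ → ZMod p) → Finset τ → Fin D ⊕ κ → (ZMod p)[X],
      (∀ h, S h ∅ = 0) ∧
      (∀ h ε k', (S h ε (Sum.inl k') -
        (powMap κ (β (e, k)) e - polyShift (∑ i ∈ ε, h i) (powMap κ (β (e, k)) e))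
          (Sum.inl k')).degree < (e - 1 : ℕ)) ∧
      (∀ h ε k', (S h ε (Sum.inr k')).natDegree ≤ d) ∧
      ‖sortedAverage T f G‖ ^ 2 ^ Fintype.card τ ≤
        𝔼 h : τ → ZMod p, ‖𝔼 z, 𝔼 n,
          (∏ ε : Finset τ, (starRingEnd ℂ)^[ε.card] (f ((z + polyVal (S h ε) n) ∘ Sum.inl))) *
            ∏ x : {i // c i ≠ (e, k)} × Finset τ, (starRingEnd ℂ)^[x.2.card] (G x.1
              (z + polyVal (S h x.2 + polyShift (∑ i ∈ x.2, h i) (T x.1)) n))‖ := by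
  classical
  set Q := powMap κ (β (e, k)) e with hQ
  have hQr (k') : (Q (Sum.inr k')) = 0 := rfl
  -- The degree bounds are kept coordinatewise: in `x` the class drops to degree `e - 1`, so the
  -- translations from the removal have degree less than `e - 1` there and cannot disturb the
  -- coefficient produced by `Q`. In the other coordinates only the bound `d` is needed.
  have hrem := hτ {i // c i = (e, k)} (Sum.elim (fun _ => e - 1) fun _ => d) (fun i => T i - Q)
    (Fintype.card_subtype_le _) ?_ ?_
  · obtain ⟨S, S0, Sr, hS⟩ := hrem.of_sub Q
      (fun z n => f (z ∘ Sum.inl) * ∏ i : {i // c i ≠ (e, k)}, G i (z + polyVal (T i) n))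
      (fun i => G i) (fun i => hG i)
    refine ⟨fun h ε => S h ε + (Q - polyShift (∑ i ∈ ε, h i) Q), fun h => by simp [S0],
      fun h ε k' => ?_, fun h ε k' => ?_, ?_⟩
    · simpa using Sr h ε (Sum.inl k')
    · refine Polynomial.natDegree_le_of_degree_le ?_
      simpa [polyShift, hQr] using (Sr h ε (Sum.inr k')).le
    · refine le_trans (le_of_eq ?_) (hS.trans (le_of_eq ?_))
      · congr 2
        refine Finset.expect_congr rfl fun z _ => Finset.expect_congr rfl fun n _ => ?_
        rw [mul_assoc, mul_comm (∏ i : {i // c i ≠ (e, k)}, _),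
          Fintype.prod_subtype_mul_prod_subtype (fun i => c i = (e, k))
            fun i => G i (z + polyVal (T i) n)]
      · refine Finset.expect_congr rfl fun h _ => ?_
        congr 1
        refine Finset.expect_congr rfl fun z _ => Finset.expect_congr rfl fun n _ => ?_
        rw [Fintype.prod_prod_type, Finset.prod_comm, ← Finset.prod_mul_distrib]
        refine Finset.prod_congr rfl fun ε _ => ?_
        rw [iter_conj_mul, iter_conj_prod]
        congr 1
        refine Finset.prod_congr rfl fun i _ => ?_
        simp only [polyVal_add, polyVal_shift, add_assoc]
  · rintro ⟨i, hi⟩ (k' | k')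
    · have h1 := h.natDegree_le i k'
      rw [hi] at h1
      refine (Polynomial.degree_sub_le _ _).trans_lt (max_lt ?_ ?_) <;>
      refine Polynomial.degree_le_natDegree.trans_lt ?_ <;>
      norm_cast <;> refine Nat.lt_succ_of_le (le_trans ?_ (le_max_right _ _))
      · exact h1
      · exact natDegree_powMap_le _ _ _
    · simp only [Pi.sub_apply, hQr, sub_zero]
      refine Polynomial.degree_le_natDegree.trans_lt ?_
      norm_cast
      exact Nat.lt_succ_of_le ((h.natDegree_le' i k').trans (le_max_left _ _))
  · rintro ⟨i, hi⟩ (k' | k')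
    · have h1 := h.natDegree_le i k'
      have h2 := h.coeff_eq i k'
      rw [hi] at h1 h2
      refine Polynomial.natDegree_le_iff_coeff_eq_zero.2 fun m hm => ?_
      simp only [Pi.sub_apply, Polynomial.coeff_sub]
      rcases eq_or_lt_of_le (show e ≤ m by simp at hm; omega) with rfl | hm'
      · rw [h2]; simp [hQ, powMap]
      · rw [Polynomial.coeff_eq_zero_of_natDegree_lt (h1.trans_lt hm'),
          Polynomial.coeff_eq_zero_of_natDegree_lt ((natDegree_powMap_le _ _ _).trans_lt hm'),
          sub_zero]
    · simp only [Pi.sub_apply, hQr, sub_zero]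
      exact h.natDegree_le' i k'

lemma coeff_taylor_of_natDegree_le {R : Type*} [CommRing R] {f : R[X]} {d : ℕ} (hf : f.natDegree ≤ d)
    (t : R) : (Polynomial.taylor t f).coeff d = f.coeff d := by
  have := Polynomial.coeff_eq_zero_of_degree_lt (degree_sub_taylor_lt hf t)
  rw [Polynomial.coeff_sub, sub_eq_zero] at this
  exact this.symm

/-- The remaining classes after a translation of lower degree. -/
lemma IsSorted.translate {τ : Type} (h : IsSorted d w b c β T)
    (hw : ∀ e' < e, w e' = 0) (hk : w e = k + 1) (S : Finset τ → Fin D ⊕ κ → (ZMod p)[X])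
    (t : Finset τ → ZMod p) (hS : ∀ ε k', (S ε (Sum.inl k')).degree < e)
    (hS' : ∀ ε k', (S ε (Sum.inr k')).natDegree ≤ d) :
    IsSorted d (Function.update w e k) b
      (fun x : {i // c i ≠ (e, k)} × Finset τ => c x.1) β
      (fun x => S x.2 + polyShift (t x.2) (T x.1)) where
  label_lt := by
    rintro ⟨⟨i, hi⟩, ε⟩
    have h1 := h.label_lt i
    dsimp only
    by_cases h2 : (c i).1 = e
    · rw [h2, Function.update_self]
      rw [h2, hk] at h1
      refine lt_of_le_of_ne (Nat.lt_succ_iff.1 h1) fun h3 => hi (Prod.ext h2 h3)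
    · rwa [Function.update_of_ne h2]
  lead_ne_zero := fun e' q hq => h.lead_ne_zero e' q <| hq.trans_le <| by
    by_cases h2 : e' = e
    · rw [h2, Function.update_self]; omega
    · rw [Function.update_of_ne h2]
  lead_mem := fun e' q hq => h.lead_mem e' q <| hq.trans_le <| by
    by_cases h2 : e' = e
    · rw [h2, Function.update_self]; omega
    · rw [Function.update_of_ne h2]
  natDegree_le := by
    rintro ⟨⟨i, hi⟩, ε⟩ k'
    have h1 : e ≤ (c i).1 := by
      by_contra! h2
      have := h.label_lt i
      rw [hw _ h2] at this
      omega
    refine (Polynomial.natDegree_add_le _ _).trans (max_le ?_ ?_)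
    · exact Polynomial.natDegree_le_of_degree_le ((hS ε k').le.trans (by exact_mod_cast h1))
    · exact (Polynomial.natDegree_taylor _ _).trans_le (h.natDegree_le i k')
  coeff_eq := by
    rintro ⟨⟨i, hi⟩, ε⟩ k'
    have h1 : e ≤ (c i).1 := by
      by_contra! h2
      have := h.label_lt i
      rw [hw _ h2] at this
      omega
    rw [Pi.add_apply, Polynomial.coeff_add, Polynomial.coeff_eq_zero_of_degree_lt
      ((hS ε k').trans_le (by exact_mod_cast h1)), zero_add]
    exact (coeff_taylor_of_natDegree_le (h.natDegree_le i k') _).trans (h.coeff_eq i k')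
  natDegree_le' := by
    rintro ⟨⟨i, hi⟩, ε⟩ k'
    refine (Polynomial.natDegree_add_le _ _).trans (max_le (hS' ε k') ?_)
    exact (Polynomial.natDegree_taylor _ _).trans_le (h.natDegree_le' i k')

end RemoveClass

/-! ### Classes of degree one -/

/-- A nonzero multiple `v` of `b` generates the same line, so `x ↦ -(x • v)` is a bijection from the
field onto that line. -/
lemma expect_smul_eq {p D : ℕ} [Fact p.Prime] {τ : Type} [Fintype τ] [DecidableEq τ]
    {b v : Fin D → ZMod p} (hv : v ≠ 0) {a : ZMod p} (ha : v = a • b)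
    [Fintype (τ → AddSubgroup.zmultiples b)] (A : (τ → Fin D → ZMod p) → ℝ) :
    𝔼 h : τ → ZMod p, A (fun i => -(h i • v)) =
      𝔼 k : τ → AddSubgroup.zmultiples b, A (fun i => (k i : Fin D → ZMod p)) := by
  have ha0 : a ≠ 0 := by rintro rfl; exact hv (by rw [ha, zero_smul])
  have hmem (x : ZMod p) : x • b ∈ AddSubgroup.zmultiples b :=
    ⟨(x.val : ℤ), by
      show ((x.val : ℤ)) • b = x • b
      rw [natCast_zsmul, ← Nat.cast_smul_eq_nsmul (ZMod p), ZMod.natCast_zmod_val]⟩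
  let g : ZMod p → AddSubgroup.zmultiples b := fun x =>
    ⟨-(x • v), by rw [ha, smul_smul, ← neg_smul]; exact hmem _⟩
  have hg : Function.Bijective g := by
    constructor
    · intro x y hxy
      have : -(x • v) = -(y • v) := congrArg Subtype.val hxy
      exact smul_left_injective _ hv (neg_injective this)
    · rintro ⟨_, m, rfl⟩
      refine ⟨-((m : ZMod p) * a⁻¹), Subtype.ext ?_⟩
      show -((-((m : ZMod p) * a⁻¹)) • v) = m • b
      rw [neg_smul, neg_neg, ha, smul_smul, mul_assoc, inv_mul_cancel₀ ha0, mul_one,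
        Int.cast_smul_eq_zsmul]
  exact Fintype.expect_bijective (fun h i => g (h i)) hg.comp_left _ _ fun h => rfl

/-- Removing a linear class translates `f` by constants only. The weight is then a cube derivative
of `f`, to which the control with one class fewer applies for each `h`. -/
lemma Controlled.update_one {d k : ℕ} {w : ℕ → ℕ} (hw : w 0 = 0)
    (h : Controlled d (Function.update w 1 k)) : Controlled d (Function.update w 1 (k + 1)) := by
  intro M
  obtain ⟨τ, i1, i2, hτ⟩ := removableBelow (max d 1 + 1) M
  obtain ⟨s, K, C, hs, hK, hC, hP⟩ := h (M * Fintype.card (Finset τ))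
  refine ⟨s + Fintype.card τ, 2 ^ Fintype.card τ * K, C, by omega,
    Nat.mul_pos (by positivity) hK, hC, ?_⟩
  intro p _ D κ J I _ _ _ _ _ b c β T f G hI hT hf hG
  classical
  obtain ⟨S, S0, Sl, Sr, hS⟩ := hT.exists_remove (e := 1) (k := k) le_rfl
    (fun I' _ r R h1 h2 h3 => hτ p _ I' r R (h1.trans hI) h2 h3) f hG
  have hβ : β (1, k) ≠ 0 := hT.lead_ne_zero 1 k (by simp)
  obtain ⟨j, a, hja⟩ := hT.lead_mem 1 k (by simp)
  have hSl (h ε k') : S h ε (Sum.inl k') = Polynomial.C (-((∑ i ∈ ε, h i) * β (1, k) k')) := by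
    have h1 := Sl h ε k'
    simp only [Nat.sub_self, Nat.cast_zero, Nat.WithBot.lt_zero_iff, Polynomial.degree_eq_bot,
      sub_eq_zero] at h1
    rw [h1]
    simp [powMap, polyShift]
    ring
  have key (h : τ → ZMod p) := hP p D κ J ({i // c i ≠ (1, k)} × Finset τ) b _ β
    (fun x => S h x.2 + polyShift (∑ i ∈ x.2, h i) (T x.1))
    (cubeDeriv f fun i => -(h i • β (1, k))) (fun x z => (starRingEnd ℂ)^[x.2.card] (G x.1 z))
    (by
      rw [Fintype.card_prod]
      exact Nat.mul_le_mul_right _ ((Fintype.card_subtype_le _).trans hI))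
    (by
      have := hT.translate (e := 1) (k := k) (by simpa using hw) (by simp) (S h)
        (fun ε => ∑ i ∈ ε, h i)
        (fun ε k' => by
          rw [hSl]; exact Polynomial.degree_C_le.trans_lt (by norm_num)) (Sr h)
      rwa [Function.update_idem] at this)
    (hf.cubeDeriv _) (fun x z => by rw [norm_iter_conj]; exact hG _ _)
  have h2 : 𝔼 h : τ → ZMod p, boxNorm (lines b s) (cubeDeriv f fun i => -(h i • β (1, k))) ≤
      boxNorm (lines b (s + Fintype.card τ)) f := by
    rw [expect_smul_eq hβ hja fun v => boxNorm (lines b s) (cubeDeriv f v)]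
    have : Nonempty (J × Fin s) := ⟨(Classical.arbitrary J, ⟨0, hs⟩)⟩
    refine (expect_boxNorm_cubeDeriv_le
      (Sum.elim (lines b s) fun _ : τ => AddSubgroup.zmultiples (b j)) hf).trans ?_
    -- Only the direction `b j` gains `|τ|` copies; monotonicity of box norms repeats the others as
    -- often.
    let σ : (J × Fin s) ⊕ τ → J × Fin (s + Fintype.card τ) :=
      Sum.elim (fun x => (x.1, Fin.castAdd _ x.2)) fun i => (j, Fin.natAdd s (Fintype.equivFin τ i))
    have hσ : Function.Injective σ := by
      rintro (⟨x, x'⟩ | x) (⟨y, y'⟩ | y) hxy <;>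
        simp only [σ, Sum.elim_inl, Sum.elim_inr, Prod.mk.injEq, Fin.ext_iff, Fin.val_castAdd,
          Fin.val_natAdd] at hxy
      · simp [hxy.1, Fin.ext_iff, hxy.2]
      · have := x'.2; omega
      · have := y'.2; omega
      · have : Fintype.equivFin τ x = Fintype.equivFin τ y := Fin.ext (by omega)
        simpa using this
    refine le_trans (le_of_eq ?_) (boxNorm_comp_le hσ (lines b (s + Fintype.card τ)) f)
    congr 1
    funext x
    rcases x with x | x <;> rfl
  rw [pow_mul]
  calc _ ≤ _ := pow_le_pow_left₀ (by positivity) hS K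
    _ ≤ _ := expect_pow_le _ (fun _ => norm_nonneg _) K
    _ ≤ 𝔼 h : τ → ZMod p, (boxNorm (lines b s) (cubeDeriv f fun i => -(h i • β (1, k))) +
          C * (p : ℝ)⁻¹) := by
        refine Finset.expect_le_expect fun h _ => le_trans (le_of_eq ?_) (key h)
        congr 2
        refine Finset.expect_congr rfl fun z _ => Finset.expect_congr rfl fun n _ => ?_
        congr 1
        refine Finset.prod_congr rfl fun ε _ => ?_
        congr 2
        funext k'
        have h3 : polyVal (S h ε) n (Sum.inl k') = -((∑ i ∈ ε, h i) * β (1, k) k') := by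
          rw [polyVal, hSl, Polynomial.eval_C]
        simp [h3, Finset.sum_mul]
    _ ≤ _ := by
        rw [Finset.expect_add_distrib, Fintype.expect_const]
        gcongr

/-! ### Classes of higher degree -/

/-- Shifting a coordinate `h i₀` with `i₀ ∈ ε` shows that the sum is equidistributed. -/
lemma expect_comp_sum {p : ℕ} [Fact p.Prime] {τ : Type} [Fintype τ] [DecidableEq τ] {ε : Finset τ}
    (hε : ε ≠ ∅) (φ : ZMod p → ℝ) :
    𝔼 h : τ → ZMod p, φ (∑ i ∈ ε, h i) = 𝔼 x, φ x := by
  obtain ⟨i₀, hi₀⟩ := Finset.nonempty_iff_ne_empty.2 hε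
  have h1 (x : ZMod p) : 𝔼 h : τ → ZMod p, φ (∑ i ∈ ε, h i) =
      𝔼 h : τ → ZMod p, φ (∑ i ∈ ε, h i + x) := by
    rw [← expect_add_right (fun h : τ → ZMod p => φ (∑ i ∈ ε, h i)) (Pi.single i₀ x)]
    refine Finset.expect_congr rfl fun h _ => ?_
    simp [Finset.sum_add_distrib, Finset.sum_pi_single', hi₀]
  calc 𝔼 h : τ → ZMod p, φ (∑ i ∈ ε, h i) = 𝔼 _x : ZMod p, 𝔼 h : τ → ZMod p, φ (∑ i ∈ ε, h i) :=
        (Fintype.expect_const _).symm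
    _ = 𝔼 x : ZMod p, 𝔼 h : τ → ZMod p, φ (∑ i ∈ ε, h i + x) :=
        Finset.expect_congr rfl fun x _ => h1 x
    _ = 𝔼 _h : τ → ZMod p, 𝔼 x, φ x := by
        rw [Finset.expect_comm]
        refine Finset.expect_congr rfl fun h _ => ?_
        simp_rw [add_comm _ (_ : ZMod p)]
        exact expect_add_right φ _
    _ = _ := Fintype.expect_const _

lemma expect_ite_sum_eq_zero {p : ℕ} [Fact p.Prime] {τ : Type} [Fintype τ] [DecidableEq τ]
    {ε : Finset τ} (hε : ε ≠ ∅) :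
    𝔼 h : τ → ZMod p, (if ∑ i ∈ ε, h i = 0 then (1 : ℝ) else 0) = (p : ℝ)⁻¹ := by
  rw [expect_comp_sum hε fun x : ZMod p => if x = 0 then (1 : ℝ) else 0,
    Fintype.expect_eq_sum_div_card]
  simp

/-- One class of degree `e + 1` is traded for at most one class of degree `e` per nonempty vertex,
formed by the translates of `f`. The translate at `∅` is `f` itself and remains the weight. -/
lemma Controlled.update_succ {d e k : ℕ} {w : ℕ → ℕ} (he : 1 ≤ e) (hw : ∀ e' ≤ e, w e' = 0)
    (h : ∀ q, Controlled d (Function.update (Function.update w (e + 1) k) e q)) :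
    Controlled d (Function.update w (e + 1) (k + 1)) := by
  intro M
  obtain ⟨τ, i1, i2, hτ⟩ := removableBelow (max d (e + 1) + 1) M
  classical
  let E := {ε : Finset τ // ε ≠ ∅}
  obtain ⟨s, K, C, hs, hK, hC, hP⟩ :=
    h (Fintype.card E) (Fintype.card E + M * Fintype.card (Finset τ))
  -- The added constants pay for the `h` with a vanishing vertex sum, at cost `1/p` per nonempty
  -- vertex, and for the primes `p ≤ e + 1`, where the trivial bound suffices.
  refine ⟨s, 2 ^ Fintype.card τ * K, C + Fintype.card E + (e + 1), hs,
    Nat.mul_pos (by positivity) hK, by positivity, ?_⟩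
  intro p _ D κ J I _ _ _ _ _ b c β T f G hI hT hf hG
  have hp0 : (0 : ℝ) < p := by exact_mod_cast (Fact.out : p.Prime).pos
  have hN := boxNorm_nonneg (lines b s) f
  rcases le_or_gt p (e + 1) with hpe | hpe
  · refine (pow_le_one₀ (norm_nonneg _) (norm_sortedAverage_le_one T hf hG)).trans ?_
    have h1 : (1 : ℝ) ≤ (e + 1) * (p : ℝ)⁻¹ := by
      rw [← div_eq_mul_inv, le_div_iff₀ hp0, one_mul]
      exact_mod_cast hpe
    have h2 : 0 ≤ (C + Fintype.card E) * (p : ℝ)⁻¹ := by positivity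
    linarith
  have hpe' : ((e : ZMod p) + 1) ≠ 0 := by
    intro h0
    have : ((e + 1 : ℕ) : ZMod p) = 0 := by exact_mod_cast h0
    rw [ZMod.natCast_eq_zero_iff] at this
    exact absurd (Nat.le_of_dvd (Nat.succ_pos _) this) (by omega)
  obtain ⟨S, S0, Sl, Sr, hS⟩ := hT.exists_remove (e := e + 1) (k := k) (Nat.le_add_left _ _)
    (fun I' _ r R h1 h2 h3 => hτ p _ I' r R (h1.trans hI) h2 h3) f hG
  have hβ : β (e + 1, k) ≠ 0 := hT.lead_ne_zero _ k (by simp)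
  obtain ⟨j, a, hja⟩ := hT.lead_mem (e + 1) k (by simp)
  have hSl (h ε k') : (S h ε (Sum.inl k')).degree < (e + 1 : ℕ) := by
    have h1 := degree_sub_taylor_lt (natDegree_powMap_le (κ := κ) (β (e + 1, k)) (e + 1) k')
      (∑ i ∈ ε, h i)
    have h2 := (Sl h ε k').trans (show ((e + 1 - 1 : ℕ) : WithBot ℕ) < (e + 1 : ℕ) by
      exact_mod_cast Nat.lt_succ_self e)
    have h3 := (Polynomial.degree_add_le _ _).trans_lt (max_lt h2 h1)
    simpa [polyShift] using h3
  have hSc (h ε k') : (S h ε (Sum.inl k')).coeff e =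
      -(((e + 1) * ∑ i ∈ ε, h i) * β (e + 1, k) k') := by
    have h1 := Polynomial.coeff_eq_zero_of_degree_lt (n := e) (Sl h ε k')
    rw [Polynomial.coeff_sub, sub_eq_zero] at h1
    rw [h1]
    generalize ∑ i ∈ ε, h i = t
    simp [powMap, polyShift, Polynomial.coeff_X_add_C_pow, Polynomial.coeff_X_pow]
    ring
  let ν : E ≃ Fin (Fintype.card E) := Fintype.equivFin E
  -- Each nonempty vertex is its own class of degree `e`, with leading coefficient `-(e + 1)(ε·h)
  -- β`; it is nonzero for `p > e + 1` and `ε·h ≠ 0`.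
  let β' (h : τ → ZMod p) : ℕ × ℕ → Fin D → ZMod p := fun x =>
    if x.1 = e then
      if hx : x.2 < Fintype.card E then
        -(((e : ZMod p) + 1) * ∑ i ∈ (ν.symm ⟨x.2, hx⟩).1, h i) • β (e + 1, k) else 0
    else β x
  have key (h : τ → ZMod p) (hh : ∀ ε : E, ∑ i ∈ ε.1, h i ≠ 0) :
      ‖sortedAverage (Sum.elim (fun ε : E => S h ε.1)
          (fun x : {i // c i ≠ (e + 1, k)} × Finset τ =>
            S h x.2 + polyShift (∑ i ∈ x.2, h i) (T x.1))) f
        (Sum.elim (fun ε z => (starRingEnd ℂ)^[ε.1.card] (f (z ∘ Sum.inl)))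
          (fun x z => (starRingEnd ℂ)^[x.2.card] (G x.1 z)))‖ ^ K ≤
        boxNorm (lines b s) f + C * (p : ℝ)⁻¹ := by
    have hT' := hT.translate (e := e + 1) (k := k) (fun e' he' => by
        rw [Function.update_of_ne (by omega)]; exact hw _ (by omega)) (by simp) (S h)
        (fun ε => ∑ i ∈ ε, h i) (hSl h) (Sr h)
    rw [Function.update_idem] at hT'
    refine hP p D κ J (E ⊕ ({i // c i ≠ (e + 1, k)} × Finset τ)) b
      (Sum.elim (fun ε => (e, (ν ε : ℕ))) fun x => c x.1) (β' h) _ f _ ?_ ?_ hf ?_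
    · rw [Fintype.card_sum, Fintype.card_prod]
      gcongr
      exact (Fintype.card_subtype_le _).trans hI
    · have hne (x : {i // c i ≠ (e + 1, k)} × Finset τ) : (c x.1).1 ≠ e := by
        intro h0
        have := hT'.label_lt x
        rw [h0, Function.update_of_ne (by omega), hw e le_rfl] at this
        omega
      constructor
      · rintro (ε | x)
        · simp
        · simp only [Sum.elim_inr]
          rw [Function.update_of_ne (hne x)]
          exact hT'.label_lt x
      · intro e' q hq
        by_cases he' : e' = e
        · subst he'
          rw [Function.update_self] at hq
          simp only [β', if_true, dif_pos hq]
          exact smul_ne_zero (neg_ne_zero.2 (mul_ne_zero hpe' (hh _))) hβ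
        · rw [Function.update_of_ne he'] at hq
          simp only [β', if_neg he']
          exact hT'.lead_ne_zero _ _ hq
      · intro e' q hq
        by_cases he' : e' = e
        · subst he'
          rw [Function.update_self] at hq
          simp only [β', if_true, dif_pos hq]
          exact ⟨j, _, by rw [hja, smul_smul]⟩
        · rw [Function.update_of_ne he'] at hq
          simp only [β', if_neg he']
          exact hT'.lead_mem _ _ hq
      · rintro (ε | x) k'
        · refine Polynomial.natDegree_le_iff_coeff_eq_zero.2 fun m hm => ?_
          exact Polynomial.coeff_eq_zero_of_degree_lt
            ((hSl h ε.1 k').trans_le (by exact_mod_cast hm))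
        · exact hT'.natDegree_le x k'
      · rintro (ε | x) k'
        · simp [β', hSc]
        · simp only [Sum.elim_inr, β', if_neg (hne x)]
          exact hT'.coeff_eq x k'
      · rintro (ε | x) k'
        · exact Sr h ε.1 k'
        · exact hT'.natDegree_le' x k'
    · rintro (ε | x) z
      · simp only [Sum.elim_inl, norm_iter_conj]; exact hf _
      · simp only [Sum.elim_inr, norm_iter_conj]; exact hG _ _
  rw [pow_mul]
  calc _ ≤ _ := pow_le_pow_left₀ (by positivity) hS K
    _ ≤ _ := expect_pow_le _ (fun _ => norm_nonneg _) K
    _ ≤ 𝔼 h : τ → ZMod p, (boxNorm (lines b s) f + C * (p : ℝ)⁻¹ +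
          ∑ ε : E, if ∑ i ∈ ε.1, h i = 0 then (1 : ℝ) else 0) := by
        refine Finset.expect_le_expect fun h _ => ?_
        have hsum : ∀ ε : E, (0 : ℝ) ≤ if ∑ i ∈ ε.1, h i = 0 then (1 : ℝ) else 0 :=
          fun ε => by split_ifs <;> norm_num
        by_cases hh : ∀ ε : E, ∑ i ∈ ε.1, h i ≠ 0
        · refine le_trans (le_of_eq ?_)
            ((key h hh).trans (le_add_of_nonneg_right (Finset.sum_nonneg fun ε _ => hsum ε)))
          congr 2
          refine Finset.expect_congr rfl fun z _ => Finset.expect_congr rfl fun n _ => ?_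
          rw [Fintype.prod_sum_type, ← mul_assoc]
          congr 1
          rw [Fintype.prod_eq_mul_prod_subtype_ne _ (∅ : Finset τ)]
          simp [S0, E]
        · push Not at hh
          obtain ⟨ε, hε⟩ := hh
          have h1 : (1 : ℝ) ≤ ∑ ε : E, if ∑ i ∈ ε.1, h i = 0 then (1 : ℝ) else 0 := by
            refine le_trans (le_of_eq (by rw [if_pos hε]))
              (Finset.single_le_sum (fun ε _ => hsum ε) (Finset.mem_univ ε))
          have h2 : 0 ≤ C * (p : ℝ)⁻¹ := by positivity
          refine le_trans (pow_le_one₀ (norm_nonneg _) ?_) (h1.trans (by linarith))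
          refine norm_expect_le_one fun z => norm_expect_le_one fun n => ?_
          rw [norm_mul]
          refine mul_le_one₀ (norm_prod_le_one _ fun ε _ => ?_) (norm_nonneg _)
            (norm_prod_le_one _ fun x _ => ?_)
          · rw [norm_iter_conj]; exact hf _
          · rw [norm_iter_conj]; exact hG _ _
    _ = boxNorm (lines b s) f + (C + Fintype.card E) * (p : ℝ)⁻¹ := by
        rw [Finset.expect_add_distrib, Fintype.expect_const, Finset.expect_sum_comm,
          Finset.sum_congr rfl fun (ε : E) _ => expect_ite_sum_eq_zero (p := p) ε.2]
        simp
        ring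
    _ ≤ _ := by
        have h1 : 0 ≤ ((e : ℝ) + 1) * (p : ℝ)⁻¹ := by positivity
        linarith

/-! ### Conclusion of the induction -/

/-- Double induction: on the degree, and within it on the number of classes. The new classes of the
next lower degree, however many, are covered by the outer induction. -/
lemma Controlled.update {d : ℕ} (e : ℕ) : ∀ (w : ℕ → ℕ), (∀ e' ≤ e + 1, w e' = 0) →
    Controlled d w → ∀ k, Controlled d (Function.update w (e + 1) k) := by
  induction e with
  | zero =>
    intro w hw h k
    induction k with
    | zero =>
      rwa [Function.update_eq_self_iff.2 (hw (0 + 1) le_rfl).symm]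
    | succ k ih => exact ih.update_one (hw 0 (Nat.zero_le _))
  | succ e ihe =>
    intro w hw h k
    induction k with
    | zero =>
      rwa [Function.update_eq_self_iff.2 (hw (e + 1 + 1) le_rfl).symm]
    | succ k ih =>
      refine Controlled.update_succ (Nat.le_add_left _ _) (fun e' he' => hw e' (by omega))
        fun q => ihe _ (fun e' he' => ?_) ih q
      rw [Function.update_of_ne (by omega)]
      exact hw e' (by omega)

/-- The class sizes are filled in from degree `m` down to `1`, so that all lower degrees are still
empty when a degree is treated. -/
theorem controlled (d m N : ℕ) : Controlled d fun e => if 1 ≤ e ∧ e ≤ m then N else 0 := by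
  have key (j : ℕ) (hj : j ≤ m) :
      Controlled d fun e => if m - j + 1 ≤ e ∧ e ≤ m then N else 0 := by
    induction j with
    | zero =>
      convert controlled_zero d using 2 with e
      rw [if_neg (by omega)]
      rfl
    | succ j ih =>
      convert Controlled.update (m - (j + 1)) _ (fun e' he' => ?_) (ih (by omega)) N using 2 with e
      · rcases eq_or_ne e (m - (j + 1) + 1) with rfl | h
        · rw [Function.update_self, if_pos (by omega)]
        · rw [Function.update_of_ne h]
          congr 1
          simp only [eq_iff_iff]
          omega
      · rw [if_neg (by omega)]
  simpa using key m le_rfl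

end BoxControl

end

noncomputable section

namespace BoxControl

/-! ### The differences to the last polynomial map -/

lemma natDegree_le_vecDegree {D : ℕ} (P : VecPoly D) (k : Fin D) :
    (P k).natDegree ≤ vecDegree P :=
  Finset.le_sup (f := fun k => (P k).natDegree) (Finset.mem_univ k)

lemma vecDegree_le {D : ℕ} {P : VecPoly D} {d : ℕ} (h : ∀ k, (P k).natDegree ≤ d) :
    vecDegree P ≤ d :=
  Finset.sup_le fun k _ => h k

lemma vecDegree_lastDiff_le {D ℓ d : ℕ} {P : Fin ℓ → VecPoly D} (h : ∀ j, vecDegree (P j) ≤ d)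
    (j : Fin ℓ) : vecDegree (lastDiff P j) ≤ d := by
  have h' : ∀ i, vecDegree (withZero P i) ≤ d := by
    refine Fin.cases (vecDegree_le fun k => ?_) h
    simp [withZero]
  exact vecDegree_le fun k => (Polynomial.natDegree_sub_le _ _).trans
    (max_le ((natDegree_le_vecDegree _ k).trans (h' _)) ((natDegree_le_vecDegree _ k).trans (h' _)))

/-- The reduction modulo `p` of `P_j - P_ℓ`. -/
def diffMap (p : ℕ) {D ℓ : ℕ} (P : Fin ℓ → VecPoly D) (j : Fin ℓ) : Fin D → (ZMod p)[X] :=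
  fun k => -(lastDiff P j k).map (Int.castRingHom (ZMod p))

lemma polyVal_diffMap {p D ℓ : ℕ} (P : Fin ℓ → VecPoly D) (j : Fin ℓ) (n : ZMod p) :
    polyVal (diffMap p P j) n =
      evalMod p (withZero P j.castSucc) n - evalMod p (withZero P (Fin.last ℓ)) n := by
  funext k
  simp [polyVal, diffMap, evalMod, lastDiff, Polynomial.eval_map]

lemma natDegree_diffMap_le {p D ℓ : ℕ} (P : Fin ℓ → VecPoly D) (j : Fin ℓ) (k : Fin D) :
    (diffMap p P j k).natDegree ≤ vecDegree (lastDiff P j) := by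
  rw [diffMap, Polynomial.natDegree_neg]
  exact Polynomial.natDegree_map_le.trans (natDegree_le_vecDegree _ k)

lemma coeff_diffMap {p D ℓ : ℕ} (P : Fin ℓ → VecPoly D) (j : Fin ℓ) (k : Fin D) :
    (diffMap p P j k).coeff (vecDegree (lastDiff P j)) = -redVec p (leadingDiff P j) k := by
  simp [diffMap, redVec, leadingDiff, vecCoeff, lastDiff]

/-- The family of the `P_j - P_ℓ`, with `P_0 = 0`, together with copies of `P_0 - P_ℓ` that move
further coordinates. -/
def diffFamily (p : ℕ) {D ℓ : ℕ} {κ I : Type} (hℓ : 0 < ℓ) (P : Fin ℓ → VecPoly D)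
    (q : I → κ → (ZMod p)[X]) : Fin ℓ ⊕ I → Fin D ⊕ κ → (ZMod p)[X] :=
  Sum.elim (fun j => Sum.elim (diffMap p P j) 0) fun i => Sum.elim (diffMap p P ⟨0, hℓ⟩) (q i)

lemma norm_sortedAverage_le {p : ℕ} [Fact p.Prime] {D : ℕ} {κ I : Type} [Fintype κ]
    [DecidableEq κ] [Fintype I] (T : I → Fin D ⊕ κ → (ZMod p)[X]) (f : (Fin D → ZMod p) → ℂ)
    {G : I → (Fin D ⊕ κ → ZMod p) → ℂ} (hG : ∀ i, OneBounded (G i)) :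
    ‖sortedAverage T f G‖ ≤ 𝔼 x, ‖f x‖ := by
  calc _ ≤ 𝔼 z : Fin D ⊕ κ → ZMod p, ‖f (z ∘ Sum.inl)‖ := by
        refine (RCLike.norm_expect_le (K := ℂ)).trans (Finset.expect_le_expect fun z _ => ?_)
        rw [← Finset.mul_expect, norm_mul]
        exact mul_le_of_le_one_right (norm_nonneg _)
          (norm_expect_le_one fun n => norm_prod_le_one _ fun i _ => hG i _)
    _ = _ := by simp [expect_sum_arrow, Sum.elim_comp_inl]

lemma exists_sortedAverage_le (d ℓ M : ℕ) (hℓ : 0 < ℓ) :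
    ∃ (s K : ℕ) (C : ℝ), 1 ≤ s ∧ 1 ≤ K ∧
      ∀ (D : ℕ) (P : Fin ℓ → VecPoly D), (∀ j, 0 < vecDegree (lastDiff P j)) →
        (∀ j, vecDegree (lastDiff P j) ≤ d) →
        ∀ (p : ℕ) [Fact p.Prime] (κ I : Type) [Fintype κ] [DecidableEq κ] [Fintype I]
          (q : I → κ → (ZMod p)[X]) (f : (Fin D → ZMod p) → ℂ)
          (G : Fin ℓ ⊕ I → (Fin D ⊕ κ → ZMod p) → ℂ),
          Fintype.card I ≤ M → (∀ i k, (q i k).natDegree ≤ d) → OneBounded f →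
          (∀ i, OneBounded (G i)) →
          ‖sortedAverage (diffFamily p hℓ P q) f G‖ ^ K ≤
            boxNormAlong p (fun i : Fin ℓ × Fin s => leadingDiff P i.1) f + C * (p : ℝ)⁻¹ := by
  obtain ⟨s, K, C, hs, hK, hC, h⟩ := controlled d d ℓ (ℓ + M)
  refine ⟨s, K, C, hs, hK, fun D P hP hPd p _ κ I _ _ _ q f G hI hq hf hG => ?_⟩
  by_cases hb : ∀ j, redVec p (leadingDiff P j) ≠ 0
  · have : Nonempty (Fin ℓ) := ⟨⟨0, hℓ⟩⟩
    -- Each index has its own label. The vector does not depend on the degree in the label, because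
    -- it must be nonzero for every admissible label, even that of an empty class.
    let β : ℕ × ℕ → Fin D → ZMod p := fun x =>
      if hx : x.2 < ℓ then -redVec p (leadingDiff P ⟨x.2, hx⟩) else 0
    have hβ (e : ℕ) (j : Fin ℓ) : β (e, j) = -redVec p (leadingDiff P j) := dif_pos j.2
    refine h p D κ (Fin ℓ) (Fin ℓ ⊕ I) (fun j => redVec p (leadingDiff P j))
      (Sum.elim (fun j => (vecDegree (lastDiff P j), (j : ℕ)))
        fun _ => (vecDegree (lastDiff P ⟨0, hℓ⟩), 0)) β
      (diffFamily p hℓ P q) f G ?_ ?_ hf hG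
    · rw [Fintype.card_sum, Fintype.card_fin]
      gcongr
    · have hlt : ∀ e q, q < (if 1 ≤ e ∧ e ≤ d then ℓ else 0) → q < ℓ := by
        intro e q h
        split_ifs at h
        · exact h
        · omega
      constructor
      · rintro (j | i)
        · exact j.2.trans_eq (if_pos ⟨hP j, hPd j⟩).symm
        · exact hℓ.trans_eq (if_pos ⟨hP _, hPd _⟩).symm
      · intro e q hq
        rw [hβ e ⟨q, hlt e q hq⟩]
        exact neg_ne_zero.2 (hb _)
      · intro e q hq
        rw [hβ e ⟨q, hlt e q hq⟩]
        exact ⟨_, -1, by rw [neg_smul, one_smul]⟩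
      · rintro (j | i) k
        · exact natDegree_diffMap_le P j k
        · exact natDegree_diffMap_le P _ k
      · rintro (j | i) k
        · exact (coeff_diffMap P j k).trans (congrFun (hβ _ j).symm k)
        · exact (coeff_diffMap P _ k).trans (congrFun (hβ _ ⟨0, hℓ⟩).symm k)
      · rintro (j | i) k
        · simp [diffFamily]
        · exact hq i k
  -- Some direction vanishes mod `p`: the box norm then dominates `𝔼 ‖f‖`, which bounds the average
  -- trivially.
  · push Not at hb
    obtain ⟨j, hj⟩ := hb
    have h1 : 𝔼 x, ‖f x‖ ≤ boxNormAlong p (fun i : Fin ℓ × Fin s => leadingDiff P i.1) f :=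
      expect_norm_le_boxNorm _ f (i := (j, ⟨0, hs⟩)) (by simp [hj])
    have h2 : 0 ≤ C * (p : ℝ)⁻¹ := by positivity
    calc _ ≤ ‖sortedAverage (diffFamily p hℓ P q) f G‖ :=
          pow_le_of_le_one (norm_nonneg _) (norm_sortedAverage_le_one _ hf hG) (by omega)
      _ ≤ _ := norm_sortedAverage_le _ f hG
      _ ≤ _ := by linarith

/-! ### Dual functions -/

lemma prod_expect {ι : Type*} [Fintype ι] [DecidableEq ι] {κ : ι → Type*} [∀ i, Fintype (κ i)]
    (A : (i : ι) → κ i → ℂ) : ∏ i, 𝔼 x, A i x = 𝔼 y : (i : ι) → κ i, ∏ i, A i (y i) := by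
  simp only [Fintype.expect_eq_sum_div_card, Finset.prod_div_distrib, Finset.prod_univ_sum,
    Fintype.card_pi, Nat.cast_prod, Fintype.piFinset_univ]

lemma prod_expect_sigma {p : ℕ} [Fact p.Prime] {L : ℕ} {k : Fin L → ℕ}
    (A : (j : Fin L) → (Fin (k j) → ZMod p) → ℂ) :
    ∏ j, 𝔼 h, A j h = 𝔼 y : (Σ j, Fin (k j)) → ZMod p, ∏ j, A j fun i => y ⟨j, i⟩ := by
  rw [prod_expect]
  exact (Fintype.expect_equiv (Equiv.piCurry fun (j : Fin L) (_ : Fin (k j)) => ZMod p) _ _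
    fun y => rfl).symm

lemma evalMod_vecMulPoly {p D : ℕ} (u : Fin D → ℤ) (ψ : ℤ[X]) (n : ZMod p) :
    evalMod p (vecMulPoly u ψ) n = ψ.eval₂ (Int.castRingHom (ZMod p)) n • redVec p u := by
  funext k
  rw [evalMod, vecMulPoly, Polynomial.eval₂_mul, Polynomial.eval₂_C, mul_comm]
  rfl

/-- The nonempty vertices of the cubes of dimensions `k j`. -/
abbrev Vertices {L : ℕ} (k : Fin L → ℕ) : Type := Σ j, {ε : Finset (Fin (k j)) // ε ≠ ∅}

lemma card_vertices_le {L d : ℕ} {k : Fin L → ℕ} (hk : ∀ j, k j ≤ d) :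
    Fintype.card (Vertices k) ≤ L * 2 ^ d := by
  rw [Fintype.card_sigma]
  refine (Finset.sum_le_card_nsmul _ _ (2 ^ d) fun j _ => ?_).trans (by simp)
  refine (Fintype.card_subtype_le _).trans ?_
  rw [Fintype.card_finset, Fintype.card_fin]
  exact Nat.pow_le_pow_right two_pos (hk j)

/-- The motion, along `ψ j`, of one coordinate that belongs to the vertex `x`. -/
def vertexMap (p : ℕ) {L : ℕ} {k : Fin L → ℕ} (ψ : Fin L → ℤ[X]) (x : Vertices k) :
    (Σ j, Fin (k j)) → (ZMod p)[X] :=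
  Pi.single ⟨x.1, x.2.1.min' (Finset.nonempty_iff_ne_empty.2 x.2.2)⟩
    ((ψ x.1).map (Int.castRingHom (ZMod p)))

/-- Only the least coordinate in `ε` moves, so the sum over `ε` moves by exactly `ψ j`, once. -/
lemma sum_polyVal_vertexMap {p : ℕ} {L : ℕ} {k : Fin L → ℕ} (ψ : Fin L → ℤ[X]) (x : Vertices k)
    (n : ZMod p) : ∑ i ∈ x.2.1, polyVal (vertexMap p ψ x) n ⟨x.1, i⟩ =
      (ψ x.1).eval₂ (Int.castRingHom (ZMod p)) n := by
  obtain ⟨j, ε, hε⟩ := x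
  have hmem := ε.min'_mem (Finset.nonempty_iff_ne_empty.2 hε)
  rw [Finset.sum_eq_single_of_mem _ hmem]
  · simp [polyVal, vertexMap, Polynomial.eval_map]
  · intro i _ hi
    have : (⟨j, i⟩ : Σ j, Fin (k j)) ≠ ⟨j, ε.min' (Finset.nonempty_iff_ne_empty.2 hε)⟩ := by
      simpa using hi
    simp [polyVal, vertexMap, Pi.single_eq_of_ne this]

/-- The twisted counting operator as an average along a sorted family. -/
lemma twistedCountingOp_eq {p : ℕ} [Fact p.Prime] {D ℓ L : ℕ} (hℓ : 0 < ℓ)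
    (P : Fin ℓ → VecPoly D) (u : Fin L → Fin D → ℤ) (ψ : Fin L → ℤ[X])
    (f : Fin (ℓ + 1) → (Fin D → ZMod p) → ℂ) (k : Fin L → ℕ)
    (F : Fin L → (Fin D → ZMod p) → ℂ) :
    twistedCountingOp p P (fun j => vecMulPoly (u j) (ψ j)) f
        (fun j => dualFunction p (k j) (u j) (F j)) =
      sortedAverage (diffFamily p hℓ P (vertexMap p (k := k) ψ)) (f (Fin.last ℓ))
        (Sum.elim (fun j z => f j.castSucc (z ∘ Sum.inl)) fun x z =>
          (starRingEnd ℂ)^[x.2.1.card] (F x.1 (z ∘ Sum.inl +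
            (∑ i ∈ x.2.1, z (Sum.inr ⟨x.1, i⟩)) • redVec p (u x.1)))) := by
  set E := evalMod p (withZero P (Fin.last ℓ)) with hE
  have h1 (x : Fin D → ZMod p) (n : ZMod p) :
      f 0 x * ∏ j : Fin ℓ, f j.succ (x + evalMod p (P j) n) =
        f (Fin.last ℓ) (x + E n) *
          ∏ j : Fin ℓ, f j.castSucc (x + E n + polyVal (diffMap p P j) n) := by
    have h2 : ∏ j : Fin (ℓ + 1), f j (x + evalMod p (withZero P j) n) =
        f 0 x * ∏ j : Fin ℓ, f j.succ (x + evalMod p (P j) n) := by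
      rw [Fin.prod_univ_succ]
      congr 2
      funext k
      simp [evalMod, withZero]
    rw [← h2, Fin.prod_univ_castSucc, mul_comm]
    congr 1
    refine Finset.prod_congr rfl fun j _ => ?_
    rw [polyVal_diffMap, add_assoc, ← hE, add_sub_cancel]
  have h3 (x : Fin D → ZMod p) (n : ZMod p) :
      ∏ j, dualFunction p (k j) (u j) (F j) (x + evalMod p (vecMulPoly (u j) (ψ j)) n) =
        𝔼 y : (Σ j, Fin (k j)) → ZMod p, ∏ v : Vertices k, (starRingEnd ℂ)^[v.2.1.card]
          (F v.1 (x + (∑ i ∈ v.2.1, (y + polyVal (vertexMap p ψ v) n) ⟨v.1, i⟩) •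
            redVec p (u v.1))) := by
    simp only [dualFunction]
    rw [prod_expect_sigma]
    refine Finset.expect_congr rfl fun y _ => ?_
    rw [Fintype.prod_sigma]
    refine Finset.prod_congr rfl fun j _ => ?_
    rw [Finset.prod_subtype (p := fun ε => ε ≠ ∅) _ (by simp)]
    refine Finset.prod_congr rfl fun ε _ => ?_
    have h4 := sum_polyVal_vertexMap ψ (⟨j, ε⟩ : Vertices k) n
    simp only [Pi.add_apply, Finset.sum_add_distrib] at h4 ⊢
    rw [h4, evalMod_vecMulPoly, add_smul, add_assoc, add_comm (_ • redVec p (u j))]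
  have h5 : twistedCountingOp p P (fun j => vecMulPoly (u j) (ψ j)) f
      (fun j => dualFunction p (k j) (u j) (F j)) =
      𝔼 z : Fin D ⊕ (Σ j, Fin (k j)) → ZMod p, 𝔼 n : ZMod p,
        (f (Fin.last ℓ) (z ∘ Sum.inl + E n) *
          ∏ j : Fin ℓ, f j.castSucc (z ∘ Sum.inl + E n + polyVal (diffMap p P j) n)) *
        ∏ v : Vertices k, (starRingEnd ℂ)^[v.2.1.card] (F v.1 (z ∘ Sum.inl +
          (∑ i ∈ v.2.1, (z ∘ Sum.inr + polyVal (vertexMap p ψ v) n) ⟨v.1, i⟩) •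
            redVec p (u v.1))) := by
    rw [twistedCountingOp, expect_sum_arrow]
    refine Finset.expect_congr rfl fun x _ => ?_
    rw [Finset.expect_comm]
    refine Finset.expect_congr rfl fun n _ => ?_
    rw [h1, h3, Finset.mul_expect]
    rfl
  rw [h5, sortedAverage]
  conv_rhs => rw [← expect_translate _ fun n => Sum.elim (E n) 0]
  refine Finset.expect_congr rfl fun z _ => Finset.expect_congr rfl fun n _ => ?_
  rw [Fintype.prod_sum_type, mul_assoc]
  congr 2
  refine Finset.prod_congr rfl fun v _ => ?_
  simp only [Sum.elim_inr]
  congr 2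
  -- The vertex functions move in `x` along `P_0 - P_ℓ`, which cancels the translation by `P_ℓ(n)`.
  have h6 : E n + polyVal (diffMap p P ⟨0, hℓ⟩) n = 0 := by
    rw [polyVal_diffMap, ← hE, add_sub_cancel]
    funext k
    simp [evalMod, withZero]
  congr 1
  · funext k'
    have h7 := congrFun h6 k'
    simp only [Pi.add_apply, Pi.zero_apply] at h7
    show z (Sum.inl k') = z (Sum.inl k') + E n k' + polyVal (diffMap p P ⟨0, hℓ⟩) n k'
    rw [add_assoc, h7, add_zero]
  · congr 1
    refine Finset.sum_congr rfl fun i _ => ?_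
    show _ = z (Sum.inr _) + 0 + polyVal (vertexMap p ψ v) n _
    rw [add_zero]
    rfl

theorem exists_twistedCountingOp_le (d ℓ L : ℕ) (hℓ : 0 < ℓ) :
    ∃ (s K : ℕ) (C : ℝ), 1 ≤ s ∧ 1 ≤ K ∧
      ∀ (D : ℕ) (P : Fin ℓ → VecPoly D) (u : Fin L → Fin D → ℤ) (ψ : Fin L → ℤ[X]),
        (∀ j, 0 < vecDegree (lastDiff P j)) → (∀ j, vecDegree (P j) ≤ d) →
        (∀ j, (ψ j).natDegree ≤ d) →
        ∀ (p : ℕ) [Fact p.Prime] (f : Fin (ℓ + 1) → (Fin D → ZMod p) → ℂ)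
          (g : Fin L → (Fin D → ZMod p) → ℂ), (∀ j, OneBounded (f j)) →
          (∀ j, g j ∈ dualFunctions p d (u j)) →
          ‖twistedCountingOp p P (fun j => vecMulPoly (u j) (ψ j)) f g‖ ^ K ≤
            boxNormAlong p (fun i : Fin ℓ × Fin s => leadingDiff P i.1) (f (Fin.last ℓ)) +
              C * (p : ℝ)⁻¹ := by
  obtain ⟨s, K, C, hs, hK, h⟩ := exists_sortedAverage_le d ℓ (L * 2 ^ d) hℓ
  refine ⟨s, K, C, hs, hK, fun D P u ψ hP hPd hψ p _ f g hf hg => ?_⟩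
  choose k hk1 hk2 F hF hgF using hg
  obtain rfl : g = fun j => dualFunction p (k j) (u j) (F j) := funext hgF
  rw [twistedCountingOp_eq hℓ]
  refine h D P hP (vecDegree_lastDiff_le hPd) p _ _ _ _ _ (card_vertices_le hk2) ?_ (hf _) ?_
  · intro x i
    rw [vertexMap]
    by_cases hi : i = ⟨x.1, x.2.1.min' (Finset.nonempty_iff_ne_empty.2 x.2.2)⟩
    · rw [hi, Pi.single_eq_same]
      exact Polynomial.natDegree_map_le.trans (hψ _)
    · rw [Pi.single_eq_of_ne hi, Polynomial.natDegree_zero]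
      exact Nat.zero_le _
  · rintro (j | x) z
    · exact hf _ _
    · simp only [Sum.elim_inr, norm_iter_conj]
      exact hF _ _

end BoxControl

end

/-! ### Deduction of the two estimates -/

open BoxControl
theorem proposition4p3 :
    -- control by a single box norm
    (∀ d D ℓ : ℕ, 1 ≤ d → 1 ≤ D → 1 ≤ ℓ →
      ∃ (s K : ℕ) (C : ℝ), 1 ≤ s ∧ 1 ≤ K ∧
        ∀ P : Fin ℓ → VecPoly D,
          EssentiallyDistinct P →
          vecDegree (withZero P (Fin.last ℓ)) = d →
          (∀ j, vecDegree (P j) ≤ d) →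
          ∀ (p : ℕ) [Fact p.Prime] (f : Fin (ℓ + 1) → (Fin D → ZMod p) → ℂ),
            (∀ j, OneBounded (f j)) →
            ‖countingOp p P f‖ ^ K ≤
              boxNormAlong p (fun i : Fin ℓ × Fin s => leadingDiff P i.1) (f (Fin.last ℓ))
                + C * (p : ℝ)⁻¹) ∧
    -- control by a single box norm for operators twisted by dual functions
    (∀ d ℓ L : ℕ, 1 ≤ d → 1 ≤ ℓ → 1 ≤ L →
      ∃ (s K : ℕ) (C : ℝ), 1 ≤ s ∧ 1 ≤ K ∧
        ∀ (D : ℕ), 1 ≤ D →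
        ∀ (v : Fin ℓ → Fin D → ℤ) (u : Fin L → Fin D → ℤ)
          (φ : Fin ℓ → Polynomial ℤ) (ψ : Fin L → Polynomial ℤ),
          (∀ j, (φ j).natDegree ≤ d) →
          (∀ j, (ψ j).natDegree ≤ d) →
          (∀ j : Fin ℓ, 0 < vecDegree (lastDiff (fun i => vecMulPoly (v i) (φ i)) j)) →
          ∃ b : Fin s → Fin D → ℤ,
            (∀ i, ∃ j : Fin ℓ, b i = leadingDiff (fun i => vecMulPoly (v i) (φ i)) j) ∧
            ∀ (p : ℕ) [Fact p.Prime] (f : Fin (ℓ + 1) → (Fin D → ZMod p) → ℂ)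
              (g : Fin L → (Fin D → ZMod p) → ℂ),
              (∀ j, OneBounded (f j)) →
              (∀ j, OneBounded (g j)) →
              (∀ j, g j ∈ dualFunctions p d (u j)) →
              ‖twistedCountingOp p (fun j => vecMulPoly (v j) (φ j))
                  (fun j => vecMulPoly (u j) (ψ j)) f g‖ ^ K ≤
                boxNormAlong p b (f (Fin.last ℓ)) + C * (p : ℝ)⁻¹) := by
  constructor
  · intro d D ℓ hd _ hℓ
    -- The untwisted operator is the case of no dual functions.
    obtain ⟨s, K, C, hs, hK, h⟩ := exists_twistedCountingOp_le d ℓ 0 hℓ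
    refine ⟨s, K, C, hs, hK, fun P hP hPl hPd p _ f hf => ?_⟩
    have hpos : ∀ j, 0 < vecDegree (lastDiff P j) := by
      obtain ⟨m, rfl⟩ : ∃ m, ℓ = m + 1 := ⟨ℓ - 1, by omega⟩
      -- For `j = 0` the difference is `P_ℓ`, of degree `d ≥ 1`; for the others essential
      -- distinctness applies.
      refine Fin.cases ?_ fun j => ?_
      · have : lastDiff P 0 = withZero P (Fin.last _) := sub_zero _
        rw [this, hPl]
        exact hd
      · exact hP (Fin.castSucc_lt_last j).ne'
    have h1 : countingOp p P f = twistedCountingOp p P (fun j : Fin 0 => vecMulPoly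
        (j.elim0 : Fin D → ℤ) (j.elim0 : Polynomial ℤ)) f fun j => j.elim0 := by
      simp [countingOp, twistedCountingOp]
    rw [h1]
    exact h D P (fun j => j.elim0) (fun j => j.elim0) hpos hPd (fun j => j.elim0) p f _ hf
      fun j => j.elim0
  · intro d ℓ L _ hℓ _
    obtain ⟨s, K, C, hs, hK, h⟩ := exists_twistedCountingOp_le d ℓ L hℓ
    -- The directions are the `ℓ` leading differences, each repeated `s` times, listed in one
    -- sequence.
    refine ⟨ℓ * s, K, C, Nat.mul_pos hℓ hs, hK, fun D _ v u φ ψ hφ hψ hpos => ?_⟩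
    refine ⟨fun i => leadingDiff (fun i => vecMulPoly (v i) (φ i)) (finProdFinEquiv.symm i).1,
      fun i => ⟨_, rfl⟩, fun p _ f g hf _ hg => ?_⟩
    refine (h D _ u ψ hpos (fun j => vecDegree_le fun k => ?_) hψ p f g hf hg).trans
      (le_of_eq ?_)
    · exact (Polynomial.natDegree_C_mul_le _ _).trans (hφ j)
    · congr 1
      rw [boxNormAlong, boxNormAlong, ← boxNorm_equiv (finProdFinEquiv (m := ℓ) (n := s)).symm]
      rfl
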